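/- \textbf{Theorem 2 (measurement of $\hat Z_L^{\otimes n}$).} Let $n\ge 0$, let $d$ be a positive odd integer, $\ell=\sqrt{2\pi/d}$, and let $\hat\rho$ be a density operator on $L^2(\mathbb R^n)$ with position and momentum operators $\hat{\mathbf q},\hat{\mathbf p}$. For $\mathbf a=(\mathbf a_X,\mathbf a_Z)\in\mathbb R^{2n}$ let $$\hat T_{\mathbf a}=e^{i\pi \mathbf a_X\cdot\mathbf a_Z/d}\,e^{-i\ell\,\mathbf a_X\cdot\hat{\mathbf p}}\,e^{i\ell\,\mathbf a_Z\cdot\hat{\mathbf q}},\qquad [\mathbf a,\mathbf b]=\mathbf a_X\cdot\mathbf b_Z-\mathbf a_Z\cdot\mathbf b_X .$$ Consider the Zak-Gross Wigner function, for $\boldsymbol\eta=(\boldsymbol\eta_X,\boldsymbol\eta_Z)\in[0,d\ell)^{2n}$, $$W_{\hat\rho}(\boldsymbol\eta)=\frac1{(2\pi)^n}\sum_{\mathbf a\in\mathbb Z^{2n}}e^{i\ell[\mathbf a,\boldsymbol\eta]+i\pi\mathbf a_X\cdot\mathbf a_Z}\,\mathrm{Tr}(\hat\rho\,\hat T_{\mathbf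 a}),$$ and the modular position measurement, for $\mathbf s\in[0,d\ell)^n$, $$\mathrm{Tr}(\hat\rho\,\hat M_Z(\mathbf s))=\frac1{(d\ell)^n}\sum_{\mathbf m\in\mathbb Z^n}e^{-i\ell\,\mathbf s\cdot\mathbf m}\,\mathrm{Tr}(\hat\rho\,\hat T_{(\mathbf 0,\mathbf m)}),$$ where both series are understood as Fourier series: a function is said to be given by the series if it is integrable on the cell and has the Fourier coefficients of the series. Then: (1) there is an integrable function $W_{\hat\rho}$ on $[0,d\ell)^{2n}$ given by the first series; (2) the second series is the Fourier series of a non-negative integrable function on $[0,d\ell)^n$, which is the probability density of the outcome $\mathbf s$ of measuring $\hat{\mathbf q} \bmod d\ell$ (that is, of the logical operator $\hat Z_L^{\otimes n}$) in the state $\hat\rho$; (3) for almost every $\mathbf s\in[0,d\ell)^n$ the function $W_{\hat\rho}(\mathbf s,\cdot)$ is integrable on $[0,d\ell)^n$ and the density is the marginal $$\mathrm{Tr}(\hat\rho\,\hat M_Z(\mathbf s))=\frac1{d^n}\int_{[0,d\ell)^n}d\boldsymbol\eta_Z\;W_{\hat\rho}(\mathbf s,\boldsymbol\eta_Z);$$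 (4) if $\sum_{\mathbf a\in\mathbb Z^{2n}}|\mathrm{Tr}(\hat\rho\,\hat T_{\mathbf a})|<\infty$, then the pointwise sums of both series are functions given by them in the above sense, and they satisfy the identity in (3) at every $\mathbf s$. -/

import Mathlib

open MeasureTheory
open scoped ENNReal

noncomputable section

namespace ZakGross

/-- The Hilbert space `L²(ℝⁿ)` of `n` modes, in the position representation. -/
abbrev Modes (n : ℕ) : Type := Lp ℂ 2 (volume : Measure (Fin n → ℝ))

/-! ### Trace and density operators -/

/-- The index set of a fixed Hilbert basis of `L²(ℝⁿ)`. -/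
def basisIndex (n : ℕ) : Set (Modes n) :=
  (exists_hilbertBasis ℂ (Modes n)).choose

/-- A fixed Hilbert basis of `L²(ℝⁿ)`. -/
def basis (n : ℕ) : HilbertBasis (basisIndex n) ℂ (Modes n) :=
  (exists_hilbertBasis ℂ (Modes n)).choose_spec.choose

/-- The trace `∑ᵢ ⟨eᵢ, A eᵢ⟩`. For trace-class `A`, the only operators it is used for, the series
converges absolutely and its sum does not depend on the basis. -/
def trace {n : ℕ} (A : Modes n →L[ℂ] Modes n) : ℂ :=
  ∑' i, inner ℂ (basis n i) (A (basis n i))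

/-- A state: a positive (in particular self-adjoint) operator whose trace converges to `1`. -/
structure IsDensityOperator {n : ℕ} (ρ : Modes n →L[ℂ] Modes n) : Prop where
  isPositive : ρ.IsPositive
  hasSum_trace : HasSum (fun i => inner ℂ (basis n i) (ρ (basis n i))) 1

/-! ### Displacement operators -/

/-- The lattice spacing `ℓ = √(2π/d)`. -/
def ell (d : ℕ) : ℝ := Real.sqrt (2 * Real.pi / d)

/-- Multiplication by an essentially bounded function `g`, as an operator on `L²(ℝⁿ)`. -/
def mulOp {n : ℕ} (g : (Fin n → ℝ) → ℂ) (hg : MemLp g ∞ volume) : Modes n →L[ℂ] Modes n :=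
  (ContinuousLinearMap.mul ℂ ℂ).holderL volume ∞ 2 2 (hg.toLp g)

theorem memLp_phase {n : ℕ} (c : ℝ) (b : Fin n → ℝ) :
    MemLp (fun x : Fin n → ℝ => Complex.exp (Complex.I * ((c * (b ⬝ᵥ x) : ℝ) : ℂ))) ∞ volume := by
  refine memLp_top_of_bound (Continuous.aestronglyMeasurable ?_) 1 (Filter.Eventually.of_forall ?_)
  · unfold dotProduct
    fun_prop
  · intro x
    rw [mul_comm, Complex.norm_exp_ofReal_mul_I]

/-- `exp(-i ℓ b · p̂)`, the translation `ψ ↦ ψ(· - ℓ b)`. -/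
def shiftX {n : ℕ} (d : ℕ) (b : Fin n → ℝ) : Modes n →L[ℂ] Modes n :=
  (Lp.compMeasurePreservingₗᵢ ℂ (fun x : Fin n → ℝ => x - ell d • b)
    (measurePreserving_sub_right volume (ell d • b))).toContinuousLinearMap

/-- `exp(i ℓ b · q̂)`, the multiplication `ψ ↦ exp(i ℓ b · x) ψ(x)`. -/
def shiftZ {n : ℕ} (d : ℕ) (b : Fin n → ℝ) : Modes n →L[ℂ] Modes n :=
  mulOp (fun x => Complex.exp (Complex.I * ((ell d * (b ⬝ᵥ x) : ℝ) : ℂ))) (memLp_phase (ell d) b)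

/-- A lattice vector `a = (a_X, a_Z)` in `ℤ²ⁿ`. -/
abbrev Lattice (n : ℕ) : Type := (Fin n → ℤ) × (Fin n → ℤ)

/-- A point `η = (η_X, η_Z)` of phase space. -/
abbrev Phase (n : ℕ) : Type := (Fin n → ℝ) × (Fin n → ℝ)

/-- The inclusion of the lattice in phase space. -/
def Lattice.toPhase {n : ℕ} (a : Lattice n) : Phase n :=
  (fun i => (a.1 i : ℝ), fun i => (a.2 i : ℝ))

/-- The displacement `T_a = exp(i π a_X · a_Z / d) exp(-i ℓ a_X · p̂) exp(i ℓ a_Z · q̂)`. -/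
def displacement {n : ℕ} (d : ℕ) (a : Phase n) : Modes n →L[ℂ] Modes n :=
  Complex.exp (Complex.I * ((Real.pi * (a.1 ⬝ᵥ a.2) / d : ℝ) : ℂ)) •
    (shiftX d a.1 ∘L shiftZ d a.2)

/-- The symplectic form `[a, b] = a_X · b_Z - a_Z · b_X`. -/
def symp {n : ℕ} (a b : Phase n) : ℝ := a.1 ⬝ᵥ b.2 - a.2 ⬝ᵥ b.1

/-- The cell `[0, dℓ)ⁿ`. -/
def cell (n d : ℕ) : Set (Fin n → ℝ) :=
  Set.univ.pi fun _ => Set.Ico 0 (d * ell d)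

/-! ### The Zak-Gross Wigner function -/

/-- `(2π)⁻ⁿ exp(i π a_X · a_Z) Tr(ρ T_a)`, the coefficient of `exp(i ℓ [a, η])` in the series
`Tr(ρ A_η) = (2π)⁻ⁿ ∑_a exp(i ℓ [a, η] + i π a_X · a_Z) Tr(ρ T_a)`. -/
def wignerCoeff {n : ℕ} (d : ℕ) (ρ : Modes n →L[ℂ] Modes n) (a : Lattice n) : ℂ :=
  (((2 * Real.pi : ℝ) : ℂ) ^ n)⁻¹ *
    Complex.exp (Complex.I * ((Real.pi * (a.toPhase.1 ⬝ᵥ a.toPhase.2) : ℝ) : ℂ)) *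
    trace (ρ ∘L displacement d a.toPhase)

/-- The series `Tr(ρ A_η)` as a pointwise sum (meaningful when it converges absolutely). -/
def wignerSeries {n : ℕ} (d : ℕ) (ρ : Modes n →L[ℂ] Modes n) (η : Phase n) : ℂ :=
  ∑' a : Lattice n,
    Complex.exp (Complex.I * ((ell d * symp a.toPhase η : ℝ) : ℂ)) * wignerCoeff d ρ a

/-- `W` is the Zak-Gross Wigner function `η ↦ Tr(ρ A_η)` of `ρ` on `[0, dℓ)²ⁿ`. The phase point
operator `A_η` is a formal Fourier series in `η`, so that `Tr(ρ A_η)` is the Fourier series of `W`: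
`W` is integrable, and its Fourier coefficients are those of the series. This determines
`W` up to null sets. -/
structure IsWigner {n : ℕ} (d : ℕ) (ρ : Modes n →L[ℂ] Modes n) (W : Phase n → ℂ) : Prop where
  integrableOn : IntegrableOn W (cell n d ×ˢ cell n d)
  coeff_eq : ∀ a : Lattice n,
    (((d * ell d : ℝ) : ℂ) ^ (2 * n))⁻¹ *
      (∫ η in cell n d ×ˢ cell n d,
        Complex.exp (-(Complex.I * ((ell d * symp a.toPhase η : ℝ) : ℂ))) * W η)
      = wignerCoeff d ρ a

/-! ### The modular position measurement -/

/-- `(dℓ)⁻ⁿ Tr(ρ T_(0,m))`, the coefficient of `exp(-i ℓ s · m)` in the series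
`Tr(ρ M_Z(s)) = (dℓ)⁻ⁿ ∑_m exp(-i ℓ s · m) Tr(ρ T_(0,m))`. -/
def modularCoeff {n : ℕ} (d : ℕ) (ρ : Modes n →L[ℂ] Modes n) (m : Fin n → ℤ) : ℂ :=
  (((d * ell d : ℝ) : ℂ) ^ n)⁻¹ * trace (ρ ∘L displacement d (Lattice.toPhase (0, m)))

/-- The series `Tr(ρ M_Z(s))` as a pointwise sum (meaningful when it converges absolutely). -/
def modularSeries {n : ℕ} (d : ℕ) (ρ : Modes n →L[ℂ] Modes n) (s : Fin n → ℝ) : ℂ :=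
  ∑' m : Fin n → ℤ,
    Complex.exp (-(Complex.I * ((ell d * (s ⬝ᵥ fun i => (m i : ℝ)) : ℝ) : ℂ))) *
      modularCoeff d ρ m

/-- `f` is the function `s ↦ Tr(ρ M_Z(s))` on `[0, dℓ)ⁿ`. As `M_Z(s)` is a formal Fourier series
in `s`, this means that `f` is integrable with the Fourier coefficients of that series. -/
structure IsModularDensity {n : ℕ} (d : ℕ) (ρ : Modes n →L[ℂ] Modes n)
    (f : (Fin n → ℝ) → ℂ) : Prop where
  integrableOn : IntegrableOn f (cell n d)
  coeff_eq : ∀ m : Fin n → ℤ,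
    (((d * ell d : ℝ) : ℂ) ^ n)⁻¹ *
      (∫ s in cell n d,
        Complex.exp (Complex.I * ((ell d * (s ⬝ᵥ fun i => (m i : ℝ)) : ℝ) : ℂ)) * f s)
      = modularCoeff d ρ m

/-- `x` modulo `L`, coordinatewise, with representatives in `[0, L)`. -/
def modVec {n : ℕ} (L : ℝ) (x : Fin n → ℝ) : Fin n → ℝ := fun i => L * Int.fract (x i / L)

theorem measurable_modVec {n : ℕ} (L : ℝ) : Measurable (modVec (n := n) L) := by
  unfold modVec
  fun_prop

theorem memLp_indicator_modVec {n : ℕ} (d : ℕ) {B : Set (Fin n → ℝ)} (hB : MeasurableSet B) :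
    MemLp (Set.indicator (modVec (d * ell d) ⁻¹' B) fun _ => (1 : ℂ)) ∞ volume := by
  refine memLp_top_of_bound ?_ 1 (Filter.Eventually.of_forall fun x => ?_)
  · exact (measurable_const.indicator (measurable_modVec _ hB)).aestronglyMeasurable
  · exact (norm_indicator_le_norm_self _ x).trans (by simp)

/-- The spectral projection of "`q̂ mod dℓ` lies in `B`". -/
def modularProj {n : ℕ} (d : ℕ) {B : Set (Fin n → ℝ)} (hB : MeasurableSet B) :
    Modes n →L[ℂ] Modes n :=
  mulOp (Set.indicator (modVec (d * ell d) ⁻¹' B) fun _ => (1 : ℂ)) (memLp_indicator_modVec d hB)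

end ZakGross

end

/-! A state is a mixture of the vectors φᵢ = √ρ eᵢ, with Tr(ρA) = ∑ᵢ ⟨φᵢ, A φᵢ⟩
(`IsDensityOperator.exists_decomposition`). It therefore suffices to treat one vector φ, with bounds
linear in ‖φ‖².

Wigner function: the Zak transform maps L²(ℝⁿ) to L² of the phase-space cell and scales squared
norms by (dℓ)ⁿ, so a product conj(Zak)·Zak lies in L¹. For the translates of φ by ∓ℓr this product
has η_Z-frequencies in dℤⁿ only; multiplied by a wave of frequency 2r it carries the coefficients
with a_X ≡ 2r mod d, and these are the displacement expectations (`inner_zak_shiftX`). As d is odd,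
2 is invertible mod d, so each a is served by exactly one r, and the sum over the dⁿ residues r is
the required L¹ function.

Density: the position distribution ∑ᵢ |φᵢ|² dx is pushed forward under reduction mod dℓ and
differentiated with respect to Lebesgue measure.

Marginal: integrating out η_Z keeps the coefficients with a_X = 0, which agree with the modular ones
up to a constant (`modularCoeff_eq`), and an L¹ function on the cell is determined by its Fourier
coefficients (`ae_eq_zero_of_fourier`). Under absolute convergence the same computation is termwise
integration, valid at every point. -/

noncomputable section

namespace ZakGross

/-! ### Traces against a density operator -/

section Trace

variable {H ι : Type*} [NormedAddCommGroup H] [InnerProductSpace ℂ H]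

theorem hasSum_norm_inner_sq (b : HilbertBasis ι ℂ H) (x : H) :
    HasSum (fun i => ‖(inner ℂ (b i) x : ℂ)‖ ^ 2) (‖x‖ ^ 2) := by
  have h := b.hasSum_inner_mul_inner x x
  have e1 : ∀ i, (inner ℂ x (b i) * inner ℂ (b i) x : ℂ)
      = ((‖(inner ℂ (b i) x : ℂ)‖ ^ 2 : ℝ) : ℂ) := fun i => by
    rw [← inner_conj_symm x (b i), RCLike.conj_mul]
    push_cast; rfl
  have e2 : (inner ℂ x x : ℂ) = ((‖x‖ ^ 2 : ℝ) : ℂ) := by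
    rw [inner_self_eq_norm_sq_to_K]
    push_cast; rfl
  simp only [e1, e2] at h
  exact Complex.hasSum_ofReal.mp h

theorem summable_norm_inner_sq_prod (b : HilbertBasis ι ℂ H) {x : ι → H}
    (hx : Summable fun i => ‖x i‖ ^ 2) :
    Summable fun q : ι × ι => ‖(inner ℂ (b q.2) (x q.1) : ℂ)‖ ^ 2 := by
  rw [summable_prod_of_nonneg (fun q => by positivity)]
  refine ⟨fun i => (hasSum_norm_inner_sq b (x i)).summable, ?_⟩
  simpa only [(hasSum_norm_inner_sq b (x _)).tsum_eq] using hx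

variable [CompleteSpace H]

/-- Cyclicity of the trace, for a Hilbert–Schmidt operator `S` and a bounded operator `A`. -/
theorem hasSum_inner_hilbertSchmidt (b : HilbertBasis ι ℂ H) {S : H →L[ℂ] H}
    (hS : IsSelfAdjoint S) (hsum : Summable fun i => ‖S (b i)‖ ^ 2) (A : H →L[ℂ] H) :
    HasSum (fun i => (inner ℂ (S (b i)) (A (S (b i))) : ℂ))
      (∑' i, inner ℂ (b i) (S (S (A (b i))))) := by
  have hsymm : ∀ x y, (inner ℂ (S x) y : ℂ) = inner ℂ x (S y) := fun x y => by
    rw [← ContinuousLinearMap.adjoint_inner_left, hS.adjoint_eq]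
  have hA : Summable fun i => ‖A.adjoint (S (b i))‖ ^ 2 := by
    refine Summable.of_nonneg_of_le (fun i => by positivity) (fun i => ?_)
      (hsum.mul_left (‖A.adjoint‖ ^ 2))
    rw [← mul_pow]
    gcongr
    exact A.adjoint.le_opNorm _
  -- Both traces are iterated sums of this one family: Parseval in the second index gives one, in
  -- the first index the other. Summability, from |xy| ≤ x² + y², permits the exchange.
  set f : ι × ι → ℂ := fun q =>
    inner ℂ (A.adjoint (S (b q.1))) (b q.2) * inner ℂ (b q.2) (S (b q.1)) with hf
  have hfs : Summable f := by
    refine Summable.of_norm_bounded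
      ((summable_norm_inner_sq_prod b hA).add (summable_norm_inner_sq_prod b hsum)) fun q => ?_
    rw [hf, norm_mul, norm_inner_symm]
    nlinarith [sq_nonneg (‖(inner ℂ (b q.2) (A.adjoint (S (b q.1))) : ℂ)‖ -
      ‖(inner ℂ (b q.2) (S (b q.1)) : ℂ)‖),
      norm_nonneg (inner ℂ (b q.2) (A.adjoint (S (b q.1))) : ℂ),
      norm_nonneg (inner ℂ (b q.2) (S (b q.1)) : ℂ)]
  have h1 : ∀ i, HasSum (fun j => f (i, j)) (inner ℂ (S (b i)) (A (S (b i)))) := fun i => by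
    have := b.hasSum_inner_mul_inner (A.adjoint (S (b i))) (S (b i))
    rwa [ContinuousLinearMap.adjoint_inner_left] at this
  have h2 : ∀ j, HasSum (fun i => f (i, j)) (inner ℂ (b j) (S (S (A (b j))))) := fun j => by
    have := b.hasSum_inner_mul_inner (S (b j)) (S (A (b j)))
    rw [hsymm] at this
    refine this.congr_fun ?_
    intro i
    simp only [hf]
    rw [ContinuousLinearMap.adjoint_inner_left, hsymm, hsymm, mul_comm]
  have h3 := hfs.hasSum.prod_fiberwise h1
  have h4 := ((Equiv.prodComm ι ι).hasSum_iff.mpr hfs.hasSum).prod_fiberwise h2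
  rwa [h4.tsum_eq]

theorem _root_.ContinuousLinearMap.IsPositive.exists_sqrt {A : H →L[ℂ] H} (hA : A.IsPositive) :
    ∃ S : H →L[ℂ] H, IsSelfAdjoint S ∧ ∀ x, A x = S (S x) := by
  have h0 : 0 ≤ A := ContinuousLinearMap.nonneg_iff_isPositive A |>.mpr hA
  refine ⟨CFC.sqrt A, (CFC.sqrt_nonneg A).isSelfAdjoint, fun x => ?_⟩
  conv_lhs => rw [← CFC.sqrt_mul_sqrt_self A h0]
  rfl

end Trace

/-- A density operator is a mixture of (unnormalized) pure states. -/
theorem IsDensityOperator.exists_decomposition {n : ℕ} {ρ : Modes n →L[ℂ] Modes n}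
    (hρ : IsDensityOperator ρ) :
    ∃ φ : basisIndex n → Modes n, HasSum (fun i => ‖φ i‖ ^ 2) 1 ∧
      ∀ A : Modes n →L[ℂ] Modes n, HasSum (fun i => inner ℂ (φ i) (A (φ i))) (trace (ρ ∘L A)) := by
  obtain ⟨S, hS, hρS⟩ := hρ.isPositive.exists_sqrt
  -- ⟨eᵢ, ρ eᵢ⟩ = ‖S eᵢ‖², so the unit trace of ρ says that its square root S is Hilbert–Schmidt.
  have hsum : HasSum (fun i => ‖S (basis n i)‖ ^ 2) 1 := by
    rw [← Complex.hasSum_ofReal]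
    convert hρ.hasSum_trace using 2 with i
    · rw [hρS, ← ContinuousLinearMap.adjoint_inner_left, hS.adjoint_eq, inner_self_eq_norm_sq_to_K]
      push_cast; rfl
    · simp
  refine ⟨fun i => S (basis n i), hsum, fun A => ?_⟩
  have := hasSum_inner_hilbertSchmidt (basis n) hS hsum.summable A
  simpa only [trace, ContinuousLinearMap.comp_apply, hρS] using this

variable {n d : ℕ}

/-! ### Plane waves on the cell -/

theorem ell_pos {d : ℕ} (hd : 0 < d) : 0 < ell d := by
  unfold ell
  positivity

theorem mul_ell_pos {d : ℕ} (hd : 0 < d) : 0 < d * ell d :=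
  mul_pos (by exact_mod_cast hd) (ell_pos hd)

/-- This makes the waves with integer `b` exactly the characters of period dℓ in each coordinate. -/
theorem ell_mul_period {d : ℕ} (hd : 0 < d) : ell d * (d * ell d) = 2 * Real.pi := by
  have : (d : ℝ) ≠ 0 := by positivity
  have h : ell d * ell d = 2 * Real.pi / d := Real.mul_self_sqrt (by positivity)
  rw [mul_left_comm, h]
  field_simp

/-- The plane wave `x ↦ exp(i ℓ b · x)`. -/
def wave {n : ℕ} (d : ℕ) (b x : Fin n → ℝ) : ℂ :=
  Complex.exp (Complex.I * ((ell d * (b ⬝ᵥ x) : ℝ) : ℂ))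

theorem norm_wave (b x : Fin n → ℝ) : ‖wave d b x‖ = 1 := by
  rw [wave, mul_comm, Complex.norm_exp_ofReal_mul_I]

@[simp] theorem wave_zero (x : Fin n → ℝ) : wave d 0 x = 1 := by simp [wave]

theorem wave_add (b c x : Fin n → ℝ) : wave d (b + c) x = wave d b x * wave d c x := by
  rw [wave, wave, wave, ← Complex.exp_add, add_dotProduct]
  push_cast
  ring_nf

theorem wave_comm (b x : Fin n → ℝ) : wave d b x = wave d x b := by
  rw [wave, wave, dotProduct_comm]

theorem wave_add_right (b x y : Fin n → ℝ) : wave d b (x + y) = wave d b x * wave d b y := by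
  simp only [wave_comm b, wave_add]

theorem conj_wave (b x : Fin n → ℝ) : (starRingEnd ℂ) (wave d b x) = wave d (-b) x := by
  rw [wave, wave, ← Complex.exp_conj, map_mul, Complex.conj_I, Complex.conj_ofReal,
    neg_dotProduct]
  push_cast
  ring_nf

theorem wave_neg (b x : Fin n → ℝ) :
    wave d (-b) x = Complex.exp (-(Complex.I * ((ell d * (b ⬝ᵥ x) : ℝ) : ℂ))) := by
  rw [wave, neg_dotProduct]
  push_cast
  ring_nf

theorem wave_eq_prod (b x : Fin n → ℝ) :
    wave d b x = ∏ i, Complex.exp (Complex.I * ((ell d * (b i * x i) : ℝ) : ℂ)) := by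
  rw [wave, ← Complex.exp_sum, dotProduct, Finset.mul_sum]
  push_cast
  rw [Finset.mul_sum]

@[fun_prop] theorem continuous_wave (b : Fin n → ℝ) : Continuous (wave d b) := by
  unfold wave dotProduct
  fun_prop

/-- An integer vector as a real vector. -/
def intVec (m : Fin n → ℤ) : Fin n → ℝ := fun i => (m i : ℝ)

@[simp] theorem intVec_zero : intVec (0 : Fin n → ℤ) = 0 := by ext; simp [intVec]

theorem intVec_add (m k : Fin n → ℤ) : intVec (m + k) = intVec m + intVec k := by
  ext; simp [intVec]

theorem intVec_sub (m k : Fin n → ℤ) : intVec (m - k) = intVec m - intVec k := by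
  ext; simp [intVec]

theorem intVec_neg (m : Fin n → ℤ) : intVec (-m) = -intVec m := by
  ext; simp [intVec]

theorem intVec_dotProduct (m k : Fin n → ℤ) : intVec m ⬝ᵥ intVec k = ((m ⬝ᵥ k : ℤ) : ℝ) := by
  simp [intVec, dotProduct]

theorem wave_period (hd : 0 < d) (m k : Fin n → ℤ) :
    wave d (intVec m) ((d * ell d) • intVec k) = 1 := by
  rw [wave, dotProduct_smul, intVec_dotProduct, smul_eq_mul, ← mul_assoc, ell_mul_period hd,
    Complex.exp_eq_one_iff]
  refine ⟨m ⬝ᵥ k, ?_⟩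
  push_cast
  ring

/-- Lebesgue measure on the cell. -/
abbrev cellMeasure (n d : ℕ) : Measure (Fin n → ℝ) := volume.restrict (cell n d)

theorem measurableSet_cell : MeasurableSet (cell n d) :=
  MeasurableSet.univ_pi fun _ => measurableSet_Ico

theorem cellMeasure_eq_pi : cellMeasure n d =
    Measure.pi fun _ : Fin n => (volume : Measure ℝ).restrict (Set.Ico 0 (d * ell d)) := by
  rw [cellMeasure, volume_pi, cell, Measure.restrict_pi_pi]

instance isFiniteMeasure_cellMeasure : IsFiniteMeasure (cellMeasure n d) := by
  rw [cellMeasure_eq_pi]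
  infer_instance

theorem integral_exp_period (hd : 0 < d) (m : ℤ) :
    ∫ x in Set.Ico 0 (d * ell d), Complex.exp (Complex.I * ((ell d * (m * x) : ℝ) : ℂ))
      = if m = 0 then ((d * ell d : ℝ) : ℂ) else 0 := by
  rw [integral_Ico_eq_integral_Ioc, ← intervalIntegral.integral_of_le (mul_ell_pos hd).le]
  split_ifs with hm
  · simp [hm]
  · have hc : Complex.I * (ell d * m : ℝ) ≠ 0 := by
      have := (ell_pos hd).ne'
      simp [hm, this]
    have h1 : ∀ x : ℝ, Complex.I * ((ell d * (m * x) : ℝ) : ℂ)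
        = Complex.I * (ell d * m : ℝ) * (x : ℂ) := fun x => by push_cast; ring
    simp_rw [h1]
    rw [integral_exp_mul_complex hc]
    have h2 : Complex.exp (Complex.I * (ell d * m : ℝ) * ((d * ell d : ℝ) : ℂ)) = 1 := by
      rw [Complex.exp_eq_one_iff]
      refine ⟨m, ?_⟩
      rw [mul_assoc, ← Complex.ofReal_mul, mul_right_comm, ell_mul_period hd]
      push_cast
      ring
    rw [h2]
    simp

theorem integral_wave (hd : 0 < d) (m : Fin n → ℤ) :
    ∫ x, wave d (intVec m) x ∂(cellMeasure n d)
      = if m = 0 then ((d * ell d : ℝ) : ℂ) ^ n else 0 := by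
  simp_rw [wave_eq_prod]
  rw [cellMeasure_eq_pi, integral_fintype_prod_eq_prod (𝕜 := ℂ)
    (fun i (x : ℝ) => Complex.exp (Complex.I * ((ell d * (intVec m i * x) : ℝ) : ℂ)))]
  simp only [intVec, integral_exp_period hd]
  split_ifs with hm
  · simp [hm]
  · obtain ⟨i, hi⟩ := Function.ne_iff.mp hm
    exact Finset.prod_eq_zero (Finset.mem_univ i) (if_neg hi)

/-! ### Tiling by translates of the cell -/

/-- Seen as level sets of the floor vector, the tiles are measurable, disjoint and covering at once;
`hasSum_integral_cell` uses this. -/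
theorem preimage_add_cell (hd : 0 < d) (k : Fin n → ℤ) :
    (fun x => x + (d * ell d) • intVec k) ⁻¹' {x : Fin n → ℝ | (fun i => ⌊x i / (d * ell d)⌋) = k}
      = cell n d := by
  have hL := mul_ell_pos hd
  ext x
  simp only [Set.mem_preimage, Set.mem_ofPred_eq, funext_iff, cell, Set.mem_univ_pi, Set.mem_Ico]
  refine forall_congr' fun i => ?_
  have : (x + (d * ell d) • intVec k) i / (d * ell d) = x i / (d * ell d) + k i := by
    simp only [Pi.add_apply, Pi.smul_apply, intVec, smul_eq_mul]
    rw [add_div, mul_div_cancel_left₀ _ hL.ne']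
  rw [this, Int.floor_add_intCast, add_eq_right, Int.floor_eq_zero_iff, Set.mem_Ico,
    le_div_iff₀ hL, div_lt_iff₀ hL, zero_mul, one_mul]

theorem hasSum_integral_cell (hd : 0 < d) {g : (Fin n → ℝ) → ℂ} (hg : Integrable g) :
    HasSum (fun k : Fin n → ℤ => ∫ x, g (x + (d * ell d) • intVec k) ∂(cellMeasure n d))
      (∫ x, g x) := by
  have hf : Measurable fun (x : Fin n → ℝ) (i : Fin n) => ⌊x i / (d * ell d)⌋ := by fun_prop
  set T : (Fin n → ℤ) → Set (Fin n → ℝ) := fun k => {x | (fun i => ⌊x i / (d * ell d)⌋) = k}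
  have hU : ⋃ k, T k = Set.univ := by
    ext x
    simp [T]
  have h := hasSum_integral_iUnion (f := g) (μ := volume) (s := T)
    (fun k => hf (measurableSet_singleton k))
    (fun j k hjk => Set.disjoint_left.mpr fun x hj hk => hjk (hj.symm.trans hk))
    hg.integrableOn
  rw [hU, setIntegral_univ] at h
  refine h.congr_fun ?_
  intro k
  rw [cellMeasure, ← preimage_add_cell hd k]
  exact (measurePreserving_add_right volume _).setIntegral_preimage_emb
    (measurableEmbedding_addRight _) g _

theorem modVec_mem_cell (hd : 0 < d) (x : Fin n → ℝ) : modVec (d * ell d) x ∈ cell n d := by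
  have hL := mul_ell_pos hd
  simp only [cell, Set.mem_univ_pi, modVec, Set.mem_Ico]
  exact fun i => ⟨mul_nonneg hL.le (Int.fract_nonneg _),
    mul_lt_of_lt_one_right hL (Int.fract_lt_one _)⟩

theorem modVec_add_floor (hd : 0 < d) (x : Fin n → ℝ) :
    modVec (d * ell d) x + (d * ell d) • intVec (fun i => ⌊x i / (d * ell d)⌋) = x := by
  have hL := mul_ell_pos hd
  ext i
  simp only [modVec, intVec, Pi.add_apply, Pi.smul_apply, smul_eq_mul, ← mul_add,
    Int.fract_add_floor]
  exact mul_div_cancel₀ _ hL.ne'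

theorem wave_modVec (hd : 0 < d) (m : Fin n → ℤ) (x : Fin n → ℝ) :
    wave d (intVec m) (modVec (d * ell d) x) = wave d (intVec m) x := by
  conv_rhs => rw [← modVec_add_floor hd x, wave_add_right, wave_period hd, mul_one]

/-- The preimage of a null set lies in the union of its countably many lattice translates. Hence
reduction mod dℓ keeps a distribution absolutely continuous. -/
theorem quasiMeasurePreserving_modVec (hd : 0 < d) :
    Measure.QuasiMeasurePreserving (modVec (n := n) (d * ell d)) volume volume := by
  refine ⟨measurable_modVec _, Measure.AbsolutelyContinuous.mk fun N hN h0 => ?_⟩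
  rw [Measure.map_apply (measurable_modVec _) hN]
  refine measure_mono_null (t := ⋃ k : Fin n → ℤ, (fun x => x - (d * ell d) • intVec k) ⁻¹' N)
    (fun x hx => ?_) (measure_iUnion_null fun k => ?_)
  · refine Set.mem_iUnion.mpr ⟨fun i => ⌊x i / (d * ell d)⌋, ?_⟩
    rwa [Set.mem_preimage, ← eq_sub_of_add_eq (modVec_add_floor hd x)]
  · rw [(measurePreserving_sub_right volume _).measure_preimage hN.nullMeasurableSet, h0]

/-! ### Uniqueness of Fourier coefficients of integrable functions -/

/-- The indicator of a closed set is a pointwise limit of continuous functions bounded by 1, so by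
dominated convergence `G` integrates to zero over every closed set. -/
theorem ae_eq_zero_of_integral_continuous_mul {X : Type*} [MetricSpace X] [CompactSpace X]
    [MeasurableSpace X] [BorelSpace X] {μ : Measure X} {G : X → ℂ} (hG : Integrable G μ)
    (h : ∀ f : C(X, ℂ), ∫ x, f x * G x ∂μ = 0) : G =ᵐ[μ] 0 := by
  refine ae_eq_zero_of_forall_setIntegral_isClosed_eq_zero hG fun s hs => ?_
  have hlim : Filter.Tendsto (fun k => ∫ x, ((hs.apprSeq k x : ℝ) : ℂ) * G x ∂μ) Filter.atTop
      (nhds (∫ x, s.indicator G x ∂μ)) := by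
    refine tendsto_integral_of_dominated_convergence (fun x => ‖G x‖)
      (fun k => ?_) hG.norm (fun k => Filter.Eventually.of_forall fun x => ?_)
      (Filter.Eventually.of_forall fun x => ?_)
    · refine AEStronglyMeasurable.mul (Continuous.aestronglyMeasurable ?_) hG.1
      fun_prop
    · rw [norm_mul]
      refine mul_le_of_le_one_left (norm_nonneg _) ?_
      have := HasOuterApproxClosed.apprSeq_apply_le_one hs k x
      simpa using this
    · have h1 := (tendsto_pi_nhds.mp (HasOuterApproxClosed.tendsto_apprSeq hs)) x
      have h2 : Filter.Tendsto (fun k => ((hs.apprSeq k x : ℝ) : ℂ) * G x) Filter.atTop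
          (nhds ((((s.indicator (fun _ => (1 : NNReal)) x : NNReal) : ℝ) : ℂ) * G x)) :=
        ((Complex.continuous_ofReal.comp NNReal.continuous_coe).continuousAt.tendsto.comp
          h1).mul_const _
      convert h2 using 2
      by_cases hx : x ∈ s <;> simp [hx]
  rw [← integral_indicator hs.measurableSet]
  refine tendsto_nhds_unique hlim ?_
  have : ∀ k, ∫ x, ((hs.apprSeq k x : ℝ) : ℂ) * G x ∂μ = 0 := fun k =>
    h ⟨fun x => ((hs.apprSeq k x : ℝ) : ℂ), by fun_prop⟩
  simp only [this, tendsto_const_nhds_iff]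

/-- `G` is only L¹, so L² completeness of the characters does not apply. Instead f ↦ ∫ f G is
continuous in the sup norm, in which trigonometric polynomials are dense. The measure is arbitrary,
so no comparison with Haar measure is needed later. -/
theorem torus_ae_eq_zero {ι : Type*} [Fintype ι] {μ : Measure (UnitAddTorus ι)}
    {G : UnitAddTorus ι → ℂ} (hG : Integrable G μ)
    (h : ∀ m, ∫ x, UnitAddTorus.mFourier m x * G x ∂μ = 0) : G =ᵐ[μ] 0 := by
  have hgi : ∀ f : C(UnitAddTorus ι, ℂ), Integrable (fun x => f x * G x) μ := fun f =>
    hG.bdd_mul (c := ‖f‖) f.continuous.aestronglyMeasurable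
      (Filter.Eventually.of_forall fun x => f.norm_coe_le_norm x)
  let Φ : C(UnitAddTorus ι, ℂ) →ₗ[ℂ] ℂ :=
    { toFun := fun f => ∫ x, f x * G x ∂μ
      map_add' := fun f g => by
        rw [← integral_add (hgi f) (hgi g)]
        exact integral_congr_ae (Filter.Eventually.of_forall fun x => by simp [add_mul])
      map_smul' := fun c f => by
        rw [RingHom.id_apply, ← integral_smul]
        exact integral_congr_ae (Filter.Eventually.of_forall fun x => by simp [mul_assoc]) }
  have hΦ : Continuous Φ := by
    refine (LinearMap.mkContinuous Φ (∫ x, ‖G x‖ ∂μ) fun f => ?_).continuous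
    calc ‖∫ x, f x * G x ∂μ‖ ≤ ∫ x, ‖f x * G x‖ ∂μ := norm_integral_le_integral_norm _
      _ ≤ ∫ x, ‖f‖ * ‖G x‖ ∂μ := by
          refine integral_mono (hgi f).norm (hG.norm.const_mul _) fun x => ?_
          simp only [norm_mul]
          gcongr
          exact f.norm_coe_le_norm x
      _ = (∫ x, ‖G x‖ ∂μ) * ‖f‖ := by rw [integral_const_mul, mul_comm]
  refine ae_eq_zero_of_integral_continuous_mul hG fun f => ?_
  have hle : (Submodule.span ℂ (Set.range (UnitAddTorus.mFourier (d := ι)))).topologicalClosure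
      ≤ LinearMap.ker Φ := by
    refine Submodule.topologicalClosure_minimal _ (Submodule.span_le.mpr ?_)
      (isClosed_singleton.preimage hΦ)
    rintro _ ⟨m, rfl⟩
    exact h m
  rw [UnitAddTorus.span_mFourier_closure_eq_top] at hle
  exact hle (Submodule.mem_top : f ∈ ⊤)

theorem ae_eq_zero_of_fourier (hd : 0 < d) {g : (Fin n → ℝ) → ℂ}
    (hg : Integrable g (cellMeasure n d))
    (h : ∀ m : Fin n → ℤ, ∫ x, wave d (intVec m) x * g x ∂(cellMeasure n d) = 0) :
    g =ᵐ[cellMeasure n d] 0 := by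
  have hL := mul_ell_pos hd
  -- `q` rescales the cell onto the unit torus and `s` inverts it there; the torus carries the
  -- pushforward measure.
  let q : (Fin n → ℝ) → UnitAddTorus (Fin n) := fun x i => ((x i / (d * ell d) : ℝ) : UnitAddCircle)
  let s : UnitAddTorus (Fin n) → (Fin n → ℝ) := fun t i =>
    (d * ell d) * (AddCircle.measurableEquivIco 1 0 (t i) : ℝ)
  have hq : Measurable q := measurable_pi_lambda _ fun i =>
    AddCircle.measurable_mk'.comp ((measurable_pi_apply i).div_const _)
  have hs : Measurable s := measurable_pi_lambda _ fun i =>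
    ((measurable_subtype_coe.comp (AddCircle.measurableEquivIco 1 0).measurable).comp
      (measurable_pi_apply i)).const_mul _
  have hsq : ∀ x ∈ cell n d, s (q x) = x := fun x hx => by
    ext i
    have hxi := hx i (Set.mem_univ i)
    have : x i / (d * ell d) ∈ Set.Ico (0 : ℝ) (0 + 1) := by
      rw [zero_add]
      exact ⟨div_nonneg hxi.1 hL.le, (div_lt_one hL).mpr hxi.2⟩
    have h2 : ((AddCircle.measurableEquivIco 1 0 (q x i) : Set.Ico (0 : ℝ) (0 + 1)) : ℝ)
      = x i / (d * ell d) := AddCircle.equivIco_coe_of_mem this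
    simp only [s, h2]
    exact mul_div_cancel₀ _ hL.ne'
  have hsq' : ∀ᵐ x ∂(cellMeasure n d), s (q x) = x :=
    (ae_restrict_iff' measurableSet_cell).mpr (Filter.Eventually.of_forall hsq)
  have hqm : MeasurePreserving q (cellMeasure n d) ((cellMeasure n d).map q) := ⟨hq, rfl⟩
  have hsm : MeasurePreserving s ((cellMeasure n d).map q) (cellMeasure n d) := by
    refine ⟨hs, ?_⟩
    rw [Measure.map_map hs hq]
    exact (Measure.map_congr hsq').trans Measure.map_id
  have hG : Integrable (g ∘ s) ((cellMeasure n d).map q) := hsm.integrable_comp_of_integrable hg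
  have h0 := torus_ae_eq_zero hG fun m => by
    refine (integral_map hq.aemeasurable
      (((UnitAddTorus.mFourier m).continuous.aestronglyMeasurable).mul hG.1)).trans ?_
    rw [← h m]
    refine integral_congr_ae ?_
    filter_upwards [hsq'] with x hx
    change UnitAddTorus.mFourier m (q x) * g (s (q x)) = _
    rw [hx]
    congr 1
    rw [wave_eq_prod]
    change ∏ i, fourier (m i) (q x i) = _
    refine Finset.prod_congr rfl fun i _ => ?_
    rw [fourier_coe_apply]
    congr 1
    have h2 : ell d = 2 * Real.pi / (d * ell d) := by
      rw [eq_div_iff hL.ne', ell_mul_period hd]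
    conv_rhs => rw [show ell d * (intVec m i * x i)
      = 2 * Real.pi / (d * ell d) * (intVec m i * x i) by rw [← h2]]
    simp only [intVec]
    push_cast
    ring
  have h1 := hqm.quasiMeasurePreserving.ae h0
  filter_upwards [hsq', h1] with x hx hx1
  simpa [hx] using hx1

/-! ### Displacements in the position representation -/

theorem coeFn_mulOp {g : (Fin n → ℝ) → ℂ} (hg : MemLp g ∞ volume) (φ : Modes n) :
    mulOp g hg φ =ᵐ[volume] fun x => g x * φ x := by
  have h1 := (ContinuousLinearMap.mul ℂ ℂ).coeFn_holder (r := 2) (hg.toLp g) φ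
  filter_upwards [h1, hg.coeFn_toLp] with x hx hgx
  rw [← hgx]
  exact hx

theorem coeFn_shiftX (b : Fin n → ℝ) (φ : Modes n) :
    shiftX d b φ =ᵐ[volume] fun x => φ (x - ell d • b) :=
  Lp.coeFn_compMeasurePreserving φ (measurePreserving_sub_right volume (ell d • b))

theorem norm_shiftX (b : Fin n → ℝ) (φ : Modes n) : ‖shiftX d b φ‖ = ‖φ‖ :=
  LinearIsometry.norm_map _ φ

theorem coeFn_shiftX_shiftZ (b c : Fin n → ℝ) (φ : Modes n) :
    shiftX d b (shiftZ d c φ) =ᵐ[volume]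
      fun x => wave d c (x - ell d • b) * φ (x - ell d • b) := by
  have h := (measurePreserving_sub_right volume (ell d • b)).quasiMeasurePreserving.ae
    (coeFn_mulOp (memLp_phase (ell d) c) φ)
  filter_upwards [coeFn_shiftX b (shiftZ d c φ), h] with x hx hx2
  rw [hx]
  exact hx2

theorem displacement_zero_left (m : Fin n → ℤ) :
    displacement d (Lattice.toPhase (0, m)) = shiftZ d (intVec m) := by
  ext1 φ
  have h : (Lattice.toPhase (0, m)).1 = (0 : Fin n → ℝ) := by ext; simp [Lattice.toPhase]
  rw [displacement, h]
  simp only [zero_dotProduct, mul_zero, zero_div, Complex.ofReal_zero, Complex.exp_zero, one_smul,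
    ContinuousLinearMap.comp_apply]
  refine Lp.ext ?_
  filter_upwards [coeFn_shiftX (d := d) 0 (shiftZ d (intVec m) φ)] with x hx
  rw [smul_zero, sub_zero] at hx
  exact hx

/-! ### The position distribution of a state -/

theorem inner_mulOp {g : (Fin n → ℝ) → ℂ} (hg : MemLp g ∞ volume) (φ : Modes n) :
    inner ℂ φ (mulOp g hg φ) = ∫ x, g x ∂(volume.withDensity fun x => ‖φ x‖ₑ ^ 2) := by
  rw [integral_withDensity_eq_integral_toReal_smul₀
    ((Lp.aestronglyMeasurable φ).enorm.pow_const 2)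
    (Filter.Eventually.of_forall fun x => by simp), L2.inner_def]
  refine integral_congr_ae ?_
  filter_upwards [coeFn_mulOp hg φ] with x hx
  rw [hx, RCLike.inner_apply, mul_assoc, RCLike.mul_conj]
  simp [mul_comm]

theorem lintegral_enorm_sq {X : Type*} [MeasurableSpace X] {μ : Measure X} (φ : Lp ℂ 2 μ) :
    ∫⁻ x, ‖φ x‖ₑ ^ 2 ∂μ = ENNReal.ofReal (‖φ‖ ^ 2) := by
  have h := eLpNorm_nnreal_pow_eq_lintegral (μ := μ) (f := φ) (p := 2) (by norm_num)
  norm_num at h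
  rw [← h, ← Lp.enorm_def, ENNReal.ofReal_pow (norm_nonneg _), ofReal_norm]

/-- The measure is the sum of the |φᵢ|² dx over a decomposition of the state; its total mass is
finite because ∑ ‖φᵢ‖² converges. -/
theorem IsDensityOperator.exists_positionMeasure {ρ : Modes n →L[ℂ] Modes n}
    (hρ : IsDensityOperator ρ) :
    ∃ ν : Measure (Fin n → ℝ), IsFiniteMeasure ν ∧ ν ≪ volume ∧
      ∀ (g : (Fin n → ℝ) → ℂ) (hg : MemLp g ∞ volume),
        trace (ρ ∘L mulOp g hg) = ∫ x, g x ∂ν := by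
  obtain ⟨φ, hφ, htr⟩ := hρ.exists_decomposition
  let ν : Measure (Fin n → ℝ) :=
    Measure.sum fun i => volume.withDensity fun x => ‖φ i x‖ₑ ^ 2
  have hfin : IsFiniteMeasure ν := by
    refine ⟨?_⟩
    simp only [ν, Measure.sum_apply _ MeasurableSet.univ, withDensity_apply _ MeasurableSet.univ,
      Measure.restrict_univ, lintegral_enorm_sq]
    exact hφ.summable.tsum_ofReal_lt_top
  have hac : ν ≪ volume :=
    Measure.absolutelyContinuous_sum_left fun i => withDensity_absolutelyContinuous _ _
  refine ⟨ν, hfin, hac, fun g hg => ?_⟩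
  -- The essential bound on `g` holds Lebesgue-a.e. and transfers to `ν` by absolute continuity.
  have hgi : Integrable g ν := by
    refine Integrable.of_bound (hg.1.mono_ac hac) (eLpNorm g ∞ volume).toReal (hac.ae_le ?_)
    filter_upwards [ae_le_eLpNormEssSup (f := g) (μ := volume)] with x hx
    rw [← toReal_enorm, eLpNorm_exponent_top]
    exact ENNReal.toReal_mono (by simpa using hg.2.ne) hx
  have h := hasSum_integral_measure hgi
  simp only [← inner_mulOp hg] at h
  exact (htr _).unique h

/-- The density is the Radon–Nikodym derivative of the position distribution reduced mod dℓ. Its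
coefficients come out right because integer waves do not change under this reduction
(`wave_modVec`). -/
theorem IsDensityOperator.exists_modularDensity (hd : 0 < d) {ρ : Modes n →L[ℂ] Modes n}
    (hρ : IsDensityOperator ρ) :
    ∃ p : (Fin n → ℝ) → ℝ, (∀ s, 0 ≤ p s) ∧ IsModularDensity d ρ (fun s => (p s : ℂ)) ∧
      ∀ (B : Set (Fin n → ℝ)) (hB : MeasurableSet B), B ⊆ cell n d →
        ((∫ s in B, p s : ℝ) : ℂ) = trace (ρ ∘L modularProj d hB) := by
  obtain ⟨ν, hfin, hac, htr⟩ := hρ.exists_positionMeasure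
  have hM := measurable_modVec (n := n) (d * ell d)
  set ν' := ν.map (modVec (d * ell d)) with hν'
  have hac' : ν' ≪ volume :=
    (hac.map hM).trans (quasiMeasurePreserving_modVec hd).absolutelyContinuous
  have hcell : ν'.restrict (cell n d) = ν' := by
    refine Measure.restrict_eq_self_of_ae_mem ?_
    exact (ae_map_iff hM.aemeasurable measurableSet_cell).mpr
      (Filter.Eventually.of_forall (modVec_mem_cell hd))
  refine ⟨fun s => (ν'.rnDeriv volume s).toReal, fun s => ENNReal.toReal_nonneg,
    ⟨(Measure.integrable_toReal_rnDeriv (μ := ν')).ofReal.integrableOn, fun m => ?_⟩,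
    fun B hB _ => ?_⟩
  · have h1 : ∀ s, Complex.exp (Complex.I * ((ell d * (s ⬝ᵥ fun i => (m i : ℝ)) : ℝ) : ℂ)) *
        (((ν'.rnDeriv volume s).toReal : ℝ) : ℂ)
        = (ν'.rnDeriv volume s).toReal • wave d (intVec m) s := fun s => by
      rw [Complex.real_smul, mul_comm, wave_comm]
      rfl
    simp only [h1]
    rw [setIntegral_rnDeriv_smul hac' measurableSet_cell, hcell, hν',
      integral_map hM.aemeasurable (continuous_wave _).aestronglyMeasurable, modularCoeff,
      displacement_zero_left, shiftZ, htr]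
    simp only [wave_modVec hd]
    rfl
  · rw [modularProj, htr, Measure.setIntegral_toReal_rnDeriv hac', hν',
      integral_indicator (hM hB), setIntegral_const, measureReal_def, measureReal_def,
      Measure.map_apply hM hB]
    simp

/-! ### The Zak transform -/

/-- The measure of the phase-space cell. -/
abbrev phaseMeasure (n d : ℕ) : Measure (Phase n) := (cellMeasure n d).prod (cellMeasure n d)

/-- The plane wave `(x, z) ↦ exp(i ℓ (m · x - c · z))` on phase space. -/
def phaseWave (d : ℕ) (m c : Fin n → ℤ) (p : Phase n) : ℂ :=
  wave d (intVec m) p.1 * wave d (-intVec c) p.2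

@[fun_prop] theorem continuous_phaseWave (m c : Fin n → ℤ) : Continuous (phaseWave d m c) := by
  unfold phaseWave
  fun_prop

theorem norm_phaseWave (m c : Fin n → ℤ) (p : Phase n) : ‖phaseWave d m c p‖ = 1 := by
  rw [phaseWave, norm_mul, norm_wave, norm_wave, one_mul]

theorem memLp_phaseWave (m c : Fin n → ℤ) :
    MemLp (phaseWave d m c) ∞ (phaseMeasure n d) :=
  memLp_top_of_bound (continuous_phaseWave m c).aestronglyMeasurable 1
    (Filter.Eventually.of_forall fun p => (norm_phaseWave m c p).le)

/-- Multiplication by a plane wave on the `L²` space of the phase-space cell. -/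
def waveMul (d : ℕ) (m c : Fin n → ℤ) :
    Lp ℂ 2 (phaseMeasure n d) →L[ℂ] Lp ℂ 2 (phaseMeasure n d) :=
  (ContinuousLinearMap.mul ℂ ℂ).holderL (phaseMeasure n d) ∞ 2 2 ((memLp_phaseWave m c).toLp _)

theorem coeFn_waveMul (m c : Fin n → ℤ) (f : Lp ℂ 2 (phaseMeasure n d)) :
    waveMul d m c f =ᵐ[phaseMeasure n d] fun p => phaseWave d m c p * f p := by
  have h1 := (ContinuousLinearMap.mul ℂ ℂ).coeFn_holder (r := 2)
    ((memLp_phaseWave (d := d) m c).toLp _) f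
  filter_upwards [h1, (memLp_phaseWave (d := d) m c).coeFn_toLp] with p hp hgp
  rw [← hgp]
  exact hp

theorem waveMul_zero (f : Lp ℂ 2 (phaseMeasure n d)) : waveMul d 0 0 f = f := by
  refine Lp.ext ?_
  filter_upwards [coeFn_waveMul 0 0 f] with p hp
  simpa [phaseWave] using hp

theorem inner_waveMul (m c : Fin n → ℤ) (f g : Lp ℂ 2 (phaseMeasure n d)) :
    inner ℂ f (waveMul d m c g) =
      ∫ p, phaseWave d m c p * ((starRingEnd ℂ) (f p) * g p) ∂(phaseMeasure n d) := by
  rw [L2.inner_def]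
  refine integral_congr_ae ?_
  filter_upwards [coeFn_waveMul m c g] with p hp
  rw [hp, RCLike.inner_apply]
  ring

theorem memLp_translate (φ : Modes n) (v : Fin n → ℝ) :
    MemLp (fun x => φ (x + v)) 2 volume :=
  (Lp.memLp φ).comp_measurePreserving (measurePreserving_add_right volume v)

/-- The `k`-th summand `φ(x + k d ℓ) exp(-i ℓ d k · z)` of the Zak transform. -/
def zakFun (d : ℕ) (φ : Modes n) (k : Fin n → ℤ) (p : Phase n) : ℂ :=
  φ (p.1 + (d * ell d) • intVec k) * wave d (-intVec ((d : ℤ) • k)) p.2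

theorem memLp_zakFun (φ : Modes n) (k : Fin n → ℤ) :
    MemLp (zakFun d φ k) 2 (phaseMeasure n d) := by
  have h := ((memLp_translate φ ((d * ell d) • intVec k)).restrict (cell n d)).comp_fst
    (cellMeasure n d)
  refine h.of_le (h.1.mul (Continuous.aestronglyMeasurable (by fun_prop)))
    (Filter.Eventually.of_forall fun p => ?_)
  rw [zakFun, norm_mul, norm_wave, mul_one]

/-- `zakFun` as an element of `L²`. -/
def zakTerm (d : ℕ) (φ : Modes n) (k : Fin n → ℤ) : Lp ℂ 2 (phaseMeasure n d) :=
  (memLp_zakFun φ k).toLp _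

/-- The integral factorises, and its z-factor is the integral of a single wave of frequency d(j - k)
- c. -/
theorem inner_zakTerm_waveMul (hd : 0 < d) (φ ψ : Modes n) (j k m c : Fin n → ℤ) :
    inner ℂ (zakTerm d φ j) (waveMul d m c (zakTerm d ψ k)) =
      (∫ x, (starRingEnd ℂ) (φ (x + (d * ell d) • intVec j)) *
          ψ (x + (d * ell d) • intVec k) * wave d (intVec m) x ∂(cellMeasure n d)) *
        if (d : ℤ) • (j - k) = c then ((d * ell d : ℝ) : ℂ) ^ n else 0 := by
  have h1 : ((d : ℤ) • (j - k) = c) ↔ ((d : ℤ) • (j - k) - c = 0) := sub_eq_zero.symm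
  rw [inner_waveMul, if_congr h1 rfl rfl, ← integral_wave hd, ← integral_prod_mul]
  refine integral_congr_ae ?_
  filter_upwards [(memLp_zakFun (d := d) φ j).coeFn_toLp,
    (memLp_zakFun (d := d) ψ k).coeFn_toLp] with p h2 h3
  have h4 : wave d (intVec ((d : ℤ) • (j - k) - c)) p.2 = wave d (intVec ((d : ℤ) • j)) p.2 *
      wave d (-intVec ((d : ℤ) • k)) p.2 * wave d (-intVec c) p.2 := by
    rw [← wave_add, ← wave_add, smul_sub, intVec_sub, intVec_sub, sub_eq_add_neg, sub_eq_add_neg]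
  rw [zakTerm, zakTerm, h2, h3, h4, zakFun, zakFun, map_mul, conj_wave, neg_neg, phaseWave]
  ring

theorem inner_zakTerm (hd : 0 < d) (φ ψ : Modes n) (j k : Fin n → ℤ) :
    inner ℂ (zakTerm d φ j) (zakTerm d ψ k) =
      (∫ x, (starRingEnd ℂ) (φ (x + (d * ell d) • intVec j)) *
          ψ (x + (d * ell d) • intVec k) ∂(cellMeasure n d)) *
        if j = k then ((d * ell d : ℝ) : ℂ) ^ n else 0 := by
  have h := inner_zakTerm_waveMul hd φ ψ j k 0 0
  have h1 : ((d : ℤ) • (j - k) = 0) ↔ j = k := by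
    rw [smul_eq_zero, sub_eq_zero, or_iff_right (by exact_mod_cast hd.ne')]
  simp only [waveMul_zero, h1, intVec_zero, wave_zero, mul_one] at h
  exact h

theorem integrable_conj_mul_translate (φ ψ : Modes n) (v : Fin n → ℝ) :
    Integrable fun x => (starRingEnd ℂ) (φ x) * ψ (x + v) :=
  (Lp.memLp φ).star.integrable_mul (memLp_translate ψ v)

theorem summable_of_orthogonal {ι E : Type*} [NormedAddCommGroup E] [InnerProductSpace ℂ E]
    [CompleteSpace E] {w : ι → E} (horth : Pairwise fun i j => (inner ℂ (w i) (w j) : ℂ) = 0)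
    (hs : Summable fun i => ‖w i‖ ^ 2) : Summable w := by
  have h : OrthogonalFamily ℂ (fun i => (Submodule.span ℂ {w i} : Submodule ℂ E))
      fun i => (Submodule.span ℂ {w i}).subtypeₗᵢ := by
    refine OrthogonalFamily.of_pairwise fun i j hij => ?_
    rw [Function.onFun, Submodule.isOrtho_span]
    rintro _ rfl _ rfl
    exact horth hij
  exact (h.summable_iff_norm_sq_summable
    fun i => ⟨w i, Submodule.mem_span_singleton_self _⟩).mpr hs

/-- The Zak transform `∑ₖ φ(x + k d ℓ) exp(-i ℓ d k · z)`, a series in `L²`. -/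
def zak (d : ℕ) (φ : Modes n) : Lp ℂ 2 (phaseMeasure n d) := ∑' k, zakTerm d φ k

/-- Distinct terms are orthogonal through their z-frequencies, and their squared norms are (dℓ)ⁿ
times the mass of `φ` on the tiles, which is summable. -/
theorem hasSum_zak (hd : 0 < d) (φ : Modes n) : HasSum (zakTerm d φ) (zak d φ) := by
  refine (summable_of_orthogonal (fun j k hjk => ?_) ?_).hasSum
  · change (inner ℂ _ _ : ℂ) = 0
    rw [inner_zakTerm hd, if_neg hjk, mul_zero]
  · rw [← Complex.summable_ofReal]
    have h0 : Integrable fun x => (starRingEnd ℂ) (φ x) * φ x := by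
      simpa using integrable_conj_mul_translate φ φ 0
    have h := (hasSum_integral_cell hd h0).summable.mul_right (((d * ell d : ℝ) : ℂ) ^ n)
    refine h.congr fun k => ?_
    have h2 := inner_zakTerm hd φ φ k k
    rw [inner_self_eq_norm_sq_to_K, if_pos rfl] at h2
    rw [← h2]
    push_cast
    rfl

/-- The Fourier coefficients of `conj (zak φ) * zak ψ` at the frequencies in `ℤⁿ × dℤⁿ`. -/
theorem inner_zak_waveMul_smul (hd : 0 < d) (φ ψ : Modes n) (m c : Fin n → ℤ) :
    inner ℂ (zak d φ) (waveMul d m ((d : ℤ) • c) (zak d ψ)) =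
      ((d * ell d : ℝ) : ℂ) ^ n *
        ∫ x, (starRingEnd ℂ) (φ x) * ψ (x - (d * ell d) • intVec c) * wave d (intVec m) x := by
  have hinj : ∀ j k : Fin n → ℤ, ((d : ℤ) • (j - k) = (d : ℤ) • c) ↔ k = j - c := fun j k => by
    rw [smul_right_inj (by exact_mod_cast hd.ne' : (d : ℤ) ≠ 0)]
    constructor <;> rintro h
    · rw [← h]; abel
    · rw [h]; abel
  -- Against the j-th term only k = j - c survives. By periodicity the wave may be evaluated at the
  -- translated point, so the sum over j is a sum over tiles of one integrand on ℝⁿ.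
  have h1 : ∀ j, inner ℂ (zakTerm d φ j) (waveMul d m ((d : ℤ) • c) (zak d ψ)) =
      ((d * ell d : ℝ) : ℂ) ^ n * ∫ x, (starRingEnd ℂ) (φ (x + (d * ell d) • intVec j)) *
        ψ (x + (d * ell d) • intVec j - (d * ell d) • intVec c) *
        wave d (intVec m) (x + (d * ell d) • intVec j) ∂(cellMeasure n d) := fun j => by
    have h := ((innerSL ℂ (zakTerm d φ j)).hasSum
      ((waveMul d m ((d : ℤ) • c)).hasSum (hasSum_zak hd ψ)))
    simp only [innerSL_apply_apply, inner_zakTerm_waveMul hd, hinj] at h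
    refine h.unique ?_
    convert hasSum_single (j - c) fun k hk => ?_ using 1
    · rw [if_pos rfl, mul_comm]
      congr 1
      refine integral_congr_ae (Filter.Eventually.of_forall fun x => ?_)
      simp only [wave_add_right, wave_period hd, intVec_sub, smul_sub, mul_one, add_sub_assoc]
    · rw [if_neg hk, mul_zero]
  have hg : Integrable fun x => (starRingEnd ℂ) (φ x) * ψ (x - (d * ell d) • intVec c) *
      wave d (intVec m) x := by
    have h := integrable_conj_mul_translate φ ψ (-((d * ell d) • intVec c))
    simp only [← sub_eq_add_neg] at h
    exact h.mul_bdd (c := 1) (continuous_wave _).aestronglyMeasurable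
      (Filter.Eventually.of_forall fun x => (norm_wave _ x).le)
  have h2 := (hasSum_integral_cell hd hg).mul_left (((d * ell d : ℝ) : ℂ) ^ n)
  have h3 := ((innerSLFlip ℂ (waveMul d m ((d : ℤ) • c) (zak d ψ))).hasSum (hasSum_zak hd φ))
  simp only [innerSLFlip_apply_apply, h1] at h3
  exact h3.unique h2

/-- Products of Zak terms have z-frequencies d(j - k) only. -/
theorem inner_zak_waveMul_eq_zero (hd : 0 < d) (φ ψ : Modes n) (m : Fin n → ℤ) {c : Fin n → ℤ}
    (hc : ∀ c', c ≠ (d : ℤ) • c') :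
    inner ℂ (zak d φ) (waveMul d m c (zak d ψ)) = (0 : ℂ) := by
  have h1 : ∀ j, inner ℂ (zakTerm d φ j) (waveMul d m c (zak d ψ)) = (0 : ℂ) := fun j => by
    have h := ((innerSL ℂ (zakTerm d φ j)).hasSum ((waveMul d m c).hasSum (hasSum_zak hd ψ)))
    simp only [innerSL_apply_apply, inner_zakTerm_waveMul hd,
      if_neg (fun h => hc _ (Eq.symm h)), mul_zero] at h
    exact h.unique hasSum_zero
  have h3 := ((innerSLFlip ℂ (waveMul d m c (zak d ψ))).hasSum (hasSum_zak hd φ))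
  simp only [innerSLFlip_apply_apply, h1] at h3
  exact h3.unique hasSum_zero

theorem norm_zak_sq (hd : 0 < d) (φ : Modes n) : ‖zak d φ‖ ^ 2 = (d * ell d) ^ n * ‖φ‖ ^ 2 := by
  have h := inner_zak_waveMul_smul hd φ φ 0 0
  have h2 : (inner ℂ φ φ : ℂ) = ∫ x, (starRingEnd ℂ) (φ x) * φ x := by
    rw [L2.inner_def]
    simp only [RCLike.inner_apply, mul_comm]
  simp only [smul_zero, waveMul_zero, intVec_zero, sub_zero, wave_zero, mul_one, ← h2] at h
  rw [inner_self_eq_norm_sq_to_K, inner_self_eq_norm_sq_to_K] at h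
  refine Complex.ofReal_injective ?_
  rw [Complex.ofReal_mul, Complex.ofReal_pow, Complex.ofReal_pow, Complex.ofReal_pow]
  exact h

/-! ### Existence of the Wigner function -/

theorem restrict_cell_prod_cell :
    (volume : Measure (Phase n)).restrict (cell n d ×ˢ cell n d) = phaseMeasure n d := by
  rw [phaseMeasure, cellMeasure, Measure.prod_restrict, ← Measure.volume_eq_prod]

theorem exp_neg_symp (a : Lattice n) (η : Phase n) :
    Complex.exp (-(Complex.I * ((ell d * symp a.toPhase η : ℝ) : ℂ))) = phaseWave d a.2 a.1 η := by
  rw [phaseWave, wave_neg, wave, ← Complex.exp_add]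
  congr 1
  change -(Complex.I * ((ell d * (intVec a.1 ⬝ᵥ η.2 - intVec a.2 ⬝ᵥ η.1) : ℝ) : ℂ)) = _
  push_cast
  ring

theorem phaseWave_mul (m c m' c' : Fin n → ℤ) (p : Phase n) :
    phaseWave d m c p * phaseWave d m' c' p = phaseWave d (m + m') (c + c') p := by
  simp only [phaseWave, intVec_add, neg_add, wave_add]
  ring

theorem inner_displacement (a : Lattice n) (φ : Modes n) :
    inner ℂ φ (displacement d a.toPhase φ) =
      Complex.exp (Complex.I * ((Real.pi * ((a.1 ⬝ᵥ a.2 : ℤ) : ℝ) / d : ℝ) : ℂ)) *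
        ∫ x, (starRingEnd ℂ) (φ x) * φ (x - ell d • intVec a.1) *
          wave d (intVec a.2) (x - ell d • intVec a.1) := by
  rw [displacement, _root_.smul_apply, inner_smul_right, L2.inner_def,
    ← intVec_dotProduct]
  congr 1
  refine integral_congr_ae ?_
  filter_upwards [coeFn_shiftX_shiftZ (d := d) (intVec a.1) (intVec a.2) φ] with x hx
  rw [RCLike.inner_apply, ContinuousLinearMap.comp_apply]
  refine (congrArg (· * _) hx).trans ?_
  ring

/-- This produces the sign exp(iπ a_X·a_Z). With A = a_X·a_Z, R = r·a_Z, K = c·a_Z one has A = 2R +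
dK, so the left phase is π(A/d + K), and K ≡ A mod 2 because d is odd. -/
theorem wave_lattice (hd : Odd d) {a : Lattice n} {r c : Fin n → ℤ}
    (h : a.1 - (2 : ℤ) • r = (d : ℤ) • c) :
    wave d (intVec a.2) (ell d • intVec (a.1 - r)) =
      Complex.exp (Complex.I * ((Real.pi * ((a.1 ⬝ᵥ a.2 : ℤ) : ℝ) : ℝ) : ℂ)) *
      Complex.exp (Complex.I * ((Real.pi * ((a.1 ⬝ᵥ a.2 : ℤ) : ℝ) / d : ℝ) : ℂ)) := by
  have hd0 : (d : ℝ) ≠ 0 := by exact_mod_cast hd.pos.ne'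
  have hl : ell d * ell d = 2 * Real.pi / d := Real.mul_self_sqrt (by positivity)
  obtain ⟨e, he⟩ := hd
  have hA : a.1 ⬝ᵥ a.2 - 2 * (r ⬝ᵥ a.2) = d * (c ⬝ᵥ a.2) := by
    have := congrArg (· ⬝ᵥ a.2) h
    simpa only [sub_dotProduct, smul_dotProduct, smul_eq_mul] using this
  have hAR : (((a.1 ⬝ᵥ a.2 : ℤ) : ℝ) - 2 * ((r ⬝ᵥ a.2 : ℤ) : ℝ)) = d * ((c ⬝ᵥ a.2 : ℤ) : ℝ) := by
    exact_mod_cast hA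
  have hdR : (d : ℝ) = 2 * e + 1 := by exact_mod_cast he
  rw [← Complex.exp_add, wave, Complex.exp_eq_exp_iff_exists_int]
  -- This integer is (K - A)/2, with d = 2e + 1.
  refine ⟨-(e * (c ⬝ᵥ a.2)) - r ⬝ᵥ a.2, ?_⟩
  rw [dotProduct_smul, smul_eq_mul, ← mul_assoc, hl, intVec_dotProduct, dotProduct_sub,
    dotProduct_comm a.2 a.1, dotProduct_comm a.2 r]
  generalize (a.1 ⬝ᵥ a.2) = A at *
  generalize (r ⬝ᵥ a.2) = R at *
  generalize (c ⬝ᵥ a.2) = K at *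
  have key : 2 * Real.pi / d * ((A : ℝ) - R) = Real.pi * A + Real.pi * A / d +
      (-(e * K) - R) * (2 * Real.pi) := by
    have hA' : (A : ℝ) = 2 * R + d * K := by linarith
    rw [hA']
    field_simp
    rw [hdR]
    ring
  have keyC := congrArg (fun t : ℝ => Complex.I * (t : ℂ)) key
  push_cast at keyC ⊢
  rw [keyC]
  ring

/-- The Fourier coefficients of the Zak product of a pure state are its displacement
expectations. -/
theorem inner_zak_shiftX (hd : Odd d) {a : Lattice n} {r c : Fin n → ℤ}
    (h : a.1 - (2 : ℤ) • r = (d : ℤ) • c) (φ : Modes n) :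
    inner ℂ (zak d (shiftX d (-intVec r) φ))
      (waveMul d a.2 (a.1 - (2 : ℤ) • r) (zak d (shiftX d (intVec r) φ))) =
      ((d * ell d : ℝ) : ℂ) ^ n *
        (Complex.exp (Complex.I * ((Real.pi * ((a.1 ⬝ᵥ a.2 : ℤ) : ℝ) : ℝ) : ℂ)) *
          inner ℂ φ (displacement d a.toPhase φ)) := by
  have hvec : (d * ell d) • intVec c = ell d • intVec a.1 - (2 * ell d) • intVec r := by
    have h2 := congrArg intVec h
    ext i
    have h3 := congrFun h2 i
    simp only [intVec, Pi.sub_apply, Pi.smul_apply, smul_eq_mul] at h3 ⊢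
    push_cast at h3
    linear_combination (-ell d) * h3
  rw [h, inner_zak_waveMul_smul hd.pos, inner_displacement, ← mul_assoc (Complex.exp _),
    ← wave_lattice hd h]
  congr 1
  rw [← integral_const_mul]
  -- Moving the variable by ℓr removes the translation from the conjugated factor; the other is then
  -- translated by dℓc + 2ℓr = ℓ a_X, as in the displacement.
  have hsub : ∀ g : (Fin n → ℝ) → ℂ, ∫ x, g x = ∫ x, g (x - ell d • intVec r) := fun g =>
    (integral_sub_right_eq_self g _).symm
  rw [hsub]
  have h1 := (measurePreserving_sub_right volume (ell d • intVec r)).quasiMeasurePreserving.ae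
    (coeFn_shiftX (d := d) (-intVec r) φ)
  have h2 := (measurePreserving_sub_right volume (ell d • intVec r)).quasiMeasurePreserving.ae
    ((measurePreserving_sub_right volume ((d * ell d) • intVec c)).quasiMeasurePreserving.ae
      (coeFn_shiftX (d := d) (intVec r) φ))
  refine integral_congr_ae ?_
  filter_upwards [h1, h2] with x hx1 hx2
  have e1 : x - ell d • intVec r - ell d • -intVec r = x := by
    rw [smul_neg, sub_neg_eq_add, sub_add_cancel]
  have e2 : x - ell d • intVec r - (d * ell d) • intVec c - ell d • intVec r
      = x - ell d • intVec a.1 := by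
    rw [hvec, two_mul, add_smul]
    abel
  have e3 : x - ell d • intVec r = ell d • intVec (a.1 - r) + (x - ell d • intVec a.1) := by
    rw [intVec_sub, smul_sub]
    abel
  rw [hx1, hx2, e1, e2, e3, wave_add_right]
  ring

/-- The summand of the Wigner function of `φ` belonging to the residue class `r`. -/
def zakProd (d : ℕ) (φ : Modes n) (r : Fin n → ℤ) (p : Phase n) : ℂ :=
  phaseWave d 0 (-((2 : ℤ) • r)) p *
    ((starRingEnd ℂ) (zak d (shiftX d (-intVec r) φ) p) * zak d (shiftX d (intVec r) φ) p)

theorem integrable_zakProd (φ : Modes n) (r : Fin n → ℤ) :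
    Integrable (zakProd d φ r) (phaseMeasure n d) := by
  have h := (Lp.memLp (zak d (shiftX d (-intVec r) φ))).star.integrable_mul
    (Lp.memLp (zak d (shiftX d (intVec r) φ)))
  exact h.bdd_mul (c := 1) (continuous_phaseWave _ _).aestronglyMeasurable
    (Filter.Eventually.of_forall fun p => (norm_phaseWave _ _ p).le)

theorem integral_norm_sq {X : Type*} [MeasurableSpace X] {μ : Measure X} (f : Lp ℂ 2 μ) :
    ∫ x, ‖f x‖ ^ 2 ∂μ = ‖f‖ ^ 2 := by
  rw [integral_eq_lintegral_of_nonneg_ae (Filter.Eventually.of_forall fun x => by positivity)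
    ((Lp.memLp f).integrable_norm_pow (by norm_num)).1]
  simp only [ENNReal.ofReal_pow (norm_nonneg _), ofReal_norm, lintegral_enorm_sq]
  rw [ENNReal.toReal_pow, toReal_enorm]

/-- |uv| ≤ (|u|² + |v|²)/2 and the norm identity for the Zak transform. Being linear in ‖φ‖², the
bound is summable over a mixture. -/
theorem integral_norm_zakProd_le (hd : 0 < d) (φ : Modes n) (r : Fin n → ℤ) :
    ∫ p, ‖zakProd d φ r p‖ ∂(phaseMeasure n d) ≤ (d * ell d) ^ n * ‖φ‖ ^ 2 := by
  have hi : ∀ f : Lp ℂ 2 (phaseMeasure n d), Integrable (fun p => ‖f p‖ ^ 2) (phaseMeasure n d) :=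
    fun f => (Lp.memLp f).integrable_norm_pow (by norm_num)
  calc ∫ p, ‖zakProd d φ r p‖ ∂(phaseMeasure n d)
      ≤ ∫ p, (‖zak d (shiftX d (-intVec r) φ) p‖ ^ 2 / 2 +
          ‖zak d (shiftX d (intVec r) φ) p‖ ^ 2 / 2) ∂(phaseMeasure n d) := by
        refine integral_mono (integrable_zakProd φ r).norm
          (((hi _).div_const 2).add ((hi _).div_const 2)) fun p => ?_
        simp only [zakProd, norm_mul, norm_phaseWave, RCLike.norm_conj, one_mul]
        nlinarith [sq_nonneg (‖zak d (shiftX d (-intVec r) φ) p‖ -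
          ‖zak d (shiftX d (intVec r) φ) p‖)]
    _ = (d * ell d) ^ n * ‖φ‖ ^ 2 := by
        rw [integral_add ((hi _).div_const 2) ((hi _).div_const 2), integral_div, integral_div,
          integral_norm_sq, integral_norm_sq, norm_zak_sq hd, norm_zak_sq hd, norm_shiftX,
          norm_shiftX]
        ring

/-- The prefactor of `zakProd` shifts a_X to a_X - 2r, which has to be a multiple of d for a nonzero
contribution. -/
theorem integral_phaseWave_mul_zakProd (φ : Modes n) (a : Lattice n) (r : Fin n → ℤ) :
    ∫ p, phaseWave d a.2 a.1 p * zakProd d φ r p ∂(phaseMeasure n d) =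
      inner ℂ (zak d (shiftX d (-intVec r) φ))
        (waveMul d a.2 (a.1 - (2 : ℤ) • r) (zak d (shiftX d (intVec r) φ))) := by
  rw [inner_waveMul]
  simp only [zakProd, ← mul_assoc, phaseWave_mul, add_zero, ← sub_eq_add_neg]

/-- The representatives of the residue classes modulo `d`. -/
def residue (r : Fin n → Fin d) : Fin n → ℤ := fun i => ((r i : ℕ) : ℤ)

theorem existsUnique_residue (hd : Odd d) (m : Fin n → ℤ) :
    ∃ r : Fin n → Fin d, (∃ c, m - (2 : ℤ) • residue r = (d : ℤ) • c) ∧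
      ∀ r' : Fin n → Fin d, (∃ c, m - (2 : ℤ) • residue r' = (d : ℤ) • c) → r' = r := by
  have hd0 : (0 : ℤ) < d := by exact_mod_cast hd.pos
  obtain ⟨e, he⟩ := hd
  -- With d = 2e + 1, the inverse of 2 mod d is e + 1.
  have hex : ∀ i, ∃ r : Fin d, ∃ c : ℤ, m i - 2 * ((r : ℕ) : ℤ) = d * c := fun i => by
    have h1 := Int.emod_nonneg (m i * (e + 1)) hd0.ne'
    have h2 := Int.emod_lt_of_pos (m i * (e + 1)) hd0
    refine ⟨⟨((m i * (e + 1)) % d).toNat, by omega⟩, -(m i) + 2 * (m i * (e + 1) / d), ?_⟩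
    have h3 := Int.emod_add_mul_ediv (m i * (e + 1)) d
    simp only [Int.toNat_of_nonneg h1]
    have he' : (d : ℤ) = 2 * e + 1 := by exact_mod_cast he
    linear_combination (-2) * h3 + (m i) * he'
  choose r c hrc using hex
  refine ⟨r, ⟨c, funext fun i => ?_⟩, ?_⟩
  · simpa [residue] using hrc i
  · rintro r' ⟨c', hc'⟩
    funext i
    have h1 : m i - 2 * ((r' i : ℕ) : ℤ) = d * c' i := by simpa [residue] using congrFun hc' i
    have h2 := hrc i
    have h3 : (d : ℤ) ∣ ((r' i : ℕ) : ℤ) - ((r i : ℕ) : ℤ) := by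
      have hcop : IsCoprime (d : ℤ) 2 := ⟨1, -e, by push_cast [he]; ring⟩
      exact hcop.dvd_of_dvd_mul_left ⟨c i - c' i, by linear_combination h2 - h1⟩
    have h4 := Int.eq_zero_of_abs_lt_dvd h3 (by rw [abs_lt]; omega)
    exact Fin.ext (by omega)

/-- Integration against a plane wave, on the `L¹` space of the phase-space cell. -/
def waveIntegral (d : ℕ) (m c : Fin n → ℤ) : Lp ℂ 1 (phaseMeasure n d) →L[ℂ] ℂ :=
  L1.integralCLM' ℂ ∘L
    (ContinuousLinearMap.mul ℂ ℂ).holderL (phaseMeasure n d) ∞ 1 1 ((memLp_phaseWave m c).toLp _)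

theorem waveIntegral_apply (m c : Fin n → ℤ) (f : Lp ℂ 1 (phaseMeasure n d)) :
    waveIntegral d m c f = ∫ p, phaseWave d m c p * f p ∂(phaseMeasure n d) := by
  have h : ∀ g : Lp ℂ 1 (phaseMeasure n d),
      L1.integralCLM' ℂ g = ∫ p, g p ∂(phaseMeasure n d) := fun g => by
    rw [← L1.integral_eq_integral]
    exact (L1.integral_eq' ℂ g).symm
  rw [waveIntegral, ContinuousLinearMap.comp_apply, h]
  refine integral_congr_ae ?_
  have h1 := (ContinuousLinearMap.mul ℂ ℂ).coeFn_holder (r := 1)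
    ((memLp_phaseWave (d := d) m c).toLp _) f
  filter_upwards [h1, (memLp_phaseWave (d := d) m c).coeFn_toLp] with p hp hgp
  rw [← hgp]
  exact hp

theorem IsDensityOperator.exists_isWigner (hd : Odd d) {ρ : Modes n →L[ℂ] Modes n}
    (hρ : IsDensityOperator ρ) : ∃ W : Phase n → ℂ, IsWigner d ρ W := by
  obtain ⟨φ, hφ, htr⟩ := hρ.exists_decomposition
  have hL : (((d * ell d : ℝ) : ℂ)) ≠ 0 := by
    exact_mod_cast (mul_ell_pos hd.pos).ne'
  let F : basisIndex n → Lp ℂ 1 (phaseMeasure n d) := fun i =>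
    ∑ r : Fin n → Fin d, (integrable_zakProd (φ i) (residue r)).toL1 _
  have hF : Summable F := by
    refine Summable.of_norm_bounded (hφ.summable.mul_left
      ((Fintype.card (Fin n → Fin d)) * (d * ell d) ^ n)) fun i => ?_
    refine (norm_sum_le _ _).trans ?_
    rw [mul_assoc, ← nsmul_eq_mul, ← Finset.card_univ]
    refine Finset.sum_le_card_nsmul _ _ _ fun r _ => ?_
    rw [L1.norm_of_fun_eq_integral_norm]
    exact integral_norm_zakProd_le hd.pos _ _
  have hcoef : ∀ (a : Lattice n) i, waveIntegral d a.2 a.1 (F i) = ((d * ell d : ℝ) : ℂ) ^ n *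
      (Complex.exp (Complex.I * ((Real.pi * ((a.1 ⬝ᵥ a.2 : ℤ) : ℝ) : ℝ) : ℂ)) *
        inner ℂ (φ i) (displacement d a.toPhase (φ i))) := fun a i => by
    have h1 : ∀ r : Fin n → Fin d, waveIntegral d a.2 a.1
        ((integrable_zakProd (d := d) (φ i) (residue r)).toL1 _) =
        inner ℂ (zak d (shiftX d (-intVec (residue r)) (φ i)))
          (waveMul d a.2 (a.1 - (2 : ℤ) • residue r)
            (zak d (shiftX d (intVec (residue r)) (φ i)))) := fun r => by
      rw [waveIntegral_apply, ← integral_phaseWave_mul_zakProd]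
      refine integral_congr_ae ?_
      filter_upwards [(integrable_zakProd (d := d) (φ i) (residue r)).coeFn_toL1] with p hp
      rw [hp]
    obtain ⟨r, ⟨c, hc⟩, huniq⟩ := existsUnique_residue hd a.1
    rw [map_sum, Finset.sum_eq_single r]
    · rw [h1, inner_zak_shiftX hd hc]
    · intro r' _ hr'
      rw [h1, inner_zak_waveMul_eq_zero hd.pos]
      exact fun c' hc' => hr' (huniq r' ⟨c', hc'⟩)
    · exact fun h => absurd (Finset.mem_univ r) h
  -- The factor (dℓ)ⁿ, with the one in `hcoef`, cancels the averaging constant (dℓ)⁻²ⁿ and leaves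
  -- (2π)⁻ⁿ.
  let C : ℂ := (((2 * Real.pi : ℝ) : ℂ) ^ n)⁻¹ * ((d * ell d : ℝ) : ℂ) ^ n
  refine ⟨fun p => C * (∑' i, F i : Lp ℂ 1 (phaseMeasure n d)) p, ?_, fun a => ?_⟩
  · rw [IntegrableOn, restrict_cell_prod_cell]
    exact (L1.integrable_coeFn _).const_mul C
  · have h1 := (waveIntegral d a.2 a.1).hasSum hF.hasSum
    simp only [hcoef] at h1
    have h2 := h1.unique (((htr (displacement d a.toPhase)).mul_left _).mul_left _)
    rw [waveIntegral_apply] at h2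
    simp only [exp_neg_symp, restrict_cell_prod_cell, mul_left_comm _ C]
    rw [integral_const_mul, h2, wignerCoeff, two_mul n, pow_add]
    change _ = _ * Complex.exp (Complex.I * ((Real.pi * (intVec a.1 ⬝ᵥ intVec a.2) : ℝ) : ℂ)) * _
    rw [intVec_dotProduct]
    simp only [C]
    field_simp

/-! ### The marginal of the Wigner function -/

/-- The sign in `wignerCoeff` is trivial at a_X = 0, and (dℓ)² = 2πd matches the constants. The
factor (dℓ)ⁿ is the volume of the cell integrated out in η_Z. -/
theorem modularCoeff_eq (hd : 0 < d) (ρ : Modes n →L[ℂ] Modes n) (m : Fin n → ℤ) :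
    modularCoeff d ρ m =
      ((d : ℂ) ^ n)⁻¹ * ((d * ell d : ℝ) : ℂ) ^ n * wignerCoeff d ρ (0, m) := by
  have hL : ((d * ell d : ℝ) : ℂ) ≠ 0 := by exact_mod_cast (mul_ell_pos hd).ne'
  have hd0 : (d : ℂ) ≠ 0 := by exact_mod_cast hd.ne'
  have hpi : ((2 * Real.pi : ℝ) : ℂ) ≠ 0 := by exact_mod_cast Real.two_pi_pos.ne'
  have hsq : ((d * ell d : ℝ) : ℂ) * ((d * ell d : ℝ) : ℂ) = d * ((2 * Real.pi : ℝ) : ℂ) := by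
    rw [← ell_mul_period hd]
    push_cast
    ring
  have hsqn : ((d * ell d : ℝ) : ℂ) ^ n * ((d * ell d : ℝ) : ℂ) ^ n =
      (d : ℂ) ^ n * ((2 * Real.pi : ℝ) : ℂ) ^ n := by
    rw [← mul_pow, hsq, mul_pow]
  have h0 : (Lattice.toPhase ((0, m) : Lattice n)).1 = 0 := by ext; simp [Lattice.toPhase]
  rw [modularCoeff, wignerCoeff, h0, zero_dotProduct, mul_zero, Complex.ofReal_zero, mul_zero,
    Complex.exp_zero, mul_one, ← mul_assoc]
  congr 1
  generalize ((d * ell d : ℝ) : ℂ) = L at *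
  generalize ((2 * Real.pi : ℝ) : ℂ) = t at *
  field_simp
  linear_combination -hsqn

theorem exp_modular (m : Fin n → ℤ) (s : Fin n → ℝ) :
    Complex.exp (Complex.I * ((ell d * (s ⬝ᵥ fun i => (m i : ℝ)) : ℝ) : ℂ)) =
      wave d (intVec m) s := by
  rw [wave_comm]
  rfl

theorem exp_neg_modular (m : Fin n → ℤ) (s : Fin n → ℝ) :
    Complex.exp (-(Complex.I * ((ell d * (s ⬝ᵥ fun i => (m i : ℝ)) : ℝ) : ℂ))) =
      wave d (-intVec m) s := by
  rw [wave_neg, dotProduct_comm]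
  rfl

/-- By Fubini the coefficients of `W` at (0, m) are those of its η_Z-integral, up to normalisation.
So the two sides have equal Fourier coefficients and agree a.e. -/
theorem IsWigner.marginal (hd : 0 < d) {ρ : Modes n →L[ℂ] Modes n} {W : Phase n → ℂ}
    {f : (Fin n → ℝ) → ℂ} (hW : IsWigner d ρ W) (hf : IsModularDensity d ρ f) :
    ∀ᵐ s ∂(volume.restrict (cell n d)),
      IntegrableOn (fun ηZ => W (s, ηZ)) (cell n d) ∧
      f s = ((d : ℂ) ^ n)⁻¹ * ∫ ηZ in cell n d, W (s, ηZ) := by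
  have hL : ((d * ell d : ℝ) : ℂ) ≠ 0 := by exact_mod_cast (mul_ell_pos hd).ne'
  have hWi : Integrable W (phaseMeasure n d) := by
    rw [← restrict_cell_prod_cell]
    exact hW.integrableOn
  have hmarg : Integrable (fun s => ∫ z, W (s, z) ∂(cellMeasure n d)) (cellMeasure n d) :=
    hWi.integral_prod_left
  have hdiff : Integrable (fun s => f s - ((d : ℂ) ^ n)⁻¹ * ∫ z, W (s, z) ∂(cellMeasure n d))
      (cellMeasure n d) := Integrable.sub hf.integrableOn (hmarg.const_mul _)
  have hwave : ∀ (m : Fin n → ℤ) {g : (Fin n → ℝ) → ℂ}, Integrable g (cellMeasure n d) →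
      Integrable (fun s => wave d (intVec m) s * g s) (cellMeasure n d) := fun m g hg =>
    hg.bdd_mul (c := 1) (continuous_wave _).aestronglyMeasurable
      (Filter.Eventually.of_forall fun x => (norm_wave _ x).le)
  have h0 := ae_eq_zero_of_fourier hd hdiff fun m => by
    have h1 := hW.coeff_eq (0, m)
    simp only [exp_neg_symp, restrict_cell_prod_cell] at h1
    have hWw : Integrable (fun p => phaseWave d m 0 p * W p) (phaseMeasure n d) :=
      hWi.bdd_mul (c := 1) (continuous_phaseWave _ _).aestronglyMeasurable
        (Filter.Eventually.of_forall fun p => (norm_phaseWave _ _ p).le)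
    rw [integral_prod _ hWw] at h1
    simp only [phaseWave, intVec_zero, neg_zero, wave_zero, mul_one, integral_const_mul] at h1
    have h2 := hf.coeff_eq m
    simp only [exp_modular] at h2
    rw [modularCoeff_eq hd, ← h1] at h2
    simp only [mul_sub, mul_left_comm _ ((d : ℂ) ^ n)⁻¹]
    rw [integral_sub (hwave m hf.integrableOn) ((hwave m hmarg).const_mul _), integral_const_mul,
      sub_eq_zero]
    rw [two_mul n, pow_add] at h2
    have hLn := pow_ne_zero n hL
    generalize ((d * ell d : ℝ) : ℂ) ^ n = L at *
    have h3 := congrArg (L * ·) h2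
    simp only [← mul_assoc, mul_inv_cancel₀ hLn, one_mul] at h3
    rw [h3]
    field_simp
  filter_upwards [hWi.prod_right_ae, h0] with s hs1 hs2
  exact ⟨hs1, sub_eq_zero.mp hs2⟩

/-! ### Absolutely convergent series -/

theorem integral_tsum_mul {X ι : Type*} [TopologicalSpace X] [MeasurableSpace X]
    [OpensMeasurableSpace X] [Countable ι] {μ : Measure X} [IsFiniteMeasure μ] {e : ι → X → ℂ}
    (he : ∀ i, Continuous (e i)) (h1 : ∀ i x, ‖e i x‖ = 1) {c : ι → ℂ} (hc : Summable c) :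
    Integrable (fun x => ∑' i, e i x * c i) μ ∧
      HasSum (fun i => (∫ x, e i x ∂μ) * c i) (∫ x, ∑' i, e i x * c i ∂μ) := by
  have hn : ∀ i x, ‖e i x * c i‖ = ‖c i‖ := fun i x => by rw [norm_mul, h1, one_mul]
  constructor
  · refine Integrable.of_bound (Continuous.aestronglyMeasurable
      (continuous_tsum (fun i => (he i).mul continuous_const) hc.norm fun i x => (hn i x).le))
      (∑' i, ‖c i‖) (Filter.Eventually.of_forall fun x => ?_)
    exact tsum_of_norm_bounded hc.norm.hasSum fun i => (hn i x).le
  · have h := hasSum_integral_of_summable_integral_norm (μ := μ)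
      (F := fun i x => e i x * c i) (fun i => ?_) ?_
    · simpa only [integral_mul_const] using h
    · exact Integrable.of_bound ((he i).mul continuous_const).aestronglyMeasurable ‖c i‖
        (Filter.Eventually.of_forall fun x => (hn i x).le)
    · simp only [hn, integral_const, smul_eq_mul]
      exact hc.norm.mul_left _

theorem wignerSeries_eq (ρ : Modes n →L[ℂ] Modes n) :
    wignerSeries d ρ = fun η => ∑' a : Lattice n, phaseWave d (-a.2) (-a.1) η * wignerCoeff d ρ a := by
  funext η
  refine tsum_congr fun a => ?_
  congr 1
  rw [← exp_neg_symp (-a.1, -a.2) η]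
  congr 1
  have : symp (Lattice.toPhase (-a.1, -a.2)) η = -symp a.toPhase η := by
    simp only [symp, Lattice.toPhase, dotProduct, Pi.neg_apply, Int.cast_neg, neg_mul,
      Finset.sum_neg_distrib]
    ring
  rw [this]
  push_cast
  ring

theorem modularSeries_eq (ρ : Modes n →L[ℂ] Modes n) :
    modularSeries d ρ = fun s => ∑' m : Fin n → ℤ, wave d (-intVec m) s * modularCoeff d ρ m := by
  funext s
  simp only [modularSeries, exp_neg_modular]

theorem integral_phaseWave (hd : 0 < d) (m c : Fin n → ℤ) :
    ∫ p, phaseWave d m c p ∂(phaseMeasure n d) =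
      if m = 0 ∧ c = 0 then ((d * ell d : ℝ) : ℂ) ^ (2 * n) else 0 := by
  simp only [phaseWave, ← intVec_neg]
  rw [integral_prod_mul, integral_wave hd, integral_wave hd, two_mul, pow_add]
  by_cases hm : m = 0 <;> by_cases hc : c = 0 <;> simp [hm, hc]

theorem isWigner_wignerSeries (hd : 0 < d) {ρ : Modes n →L[ℂ] Modes n}
    (hs : Summable fun a : Lattice n => wignerCoeff d ρ a) :
    IsWigner d ρ (wignerSeries d ρ) := by
  have hL : ((d * ell d : ℝ) : ℂ) ≠ 0 := by exact_mod_cast (mul_ell_pos hd).ne'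
  refine ⟨?_, fun a => ?_⟩
  · rw [IntegrableOn, restrict_cell_prod_cell, wignerSeries_eq]
    exact (integral_tsum_mul (fun a => continuous_phaseWave _ _) (fun a => norm_phaseWave _ _)
      hs).1
  -- The test wave is absorbed into the family, so orthogonality leaves only the term b = a.
  · have h := (integral_tsum_mul (μ := phaseMeasure n d)
      (e := fun (b : Lattice n) => phaseWave d (a.2 + -b.2) (a.1 + -b.1))
      (fun b => continuous_phaseWave _ _) (fun b => norm_phaseWave _ _) hs).2
    simp only [integral_phaseWave hd, add_neg_eq_zero] at h
    have h2 := h.unique (hasSum_single a fun b hb => by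
      rw [if_neg, zero_mul]
      exact fun ⟨h1, h2⟩ => hb (Prod.ext h2.symm h1.symm))
    simp only [and_self, if_true, ← phaseWave_mul, mul_assoc, tsum_mul_left] at h2
    simp only [exp_neg_symp, restrict_cell_prod_cell, wignerSeries_eq]
    rw [h2, inv_mul_cancel_left₀ (pow_ne_zero _ hL)]

theorem summable_modularCoeff (hd : 0 < d) {ρ : Modes n →L[ℂ] Modes n}
    (hs : Summable fun a : Lattice n => wignerCoeff d ρ a) :
    Summable (modularCoeff d ρ) := by
  refine ((hs.comp_injective (i := fun m : Fin n → ℤ => ((0, m) : Lattice n))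
    (fun m m' h => (Prod.ext_iff.mp h).2)).mul_left
      (((d : ℂ) ^ n)⁻¹ * ((d * ell d : ℝ) : ℂ) ^ n)).congr fun m => ?_
  rw [modularCoeff_eq hd]
  rfl

theorem isModularDensity_modularSeries (hd : 0 < d) {ρ : Modes n →L[ℂ] Modes n}
    (hs : Summable (modularCoeff d ρ)) : IsModularDensity d ρ (modularSeries d ρ) := by
  have hL : ((d * ell d : ℝ) : ℂ) ≠ 0 := by exact_mod_cast (mul_ell_pos hd).ne'
  refine ⟨?_, fun m => ?_⟩
  · rw [IntegrableOn, modularSeries_eq]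
    exact (integral_tsum_mul (fun a => continuous_wave _) (fun a => norm_wave _) hs).1
  · have h := (integral_tsum_mul (μ := cellMeasure n d)
      (e := fun k : Fin n → ℤ => wave d (intVec m + -intVec k))
      (fun b => continuous_wave _) (fun b => norm_wave _) hs).2
    have he : ∀ k : Fin n → ℤ, ∫ s, wave d (intVec m + -intVec k) s ∂(cellMeasure n d) =
        if m - k = 0 then ((d * ell d : ℝ) : ℂ) ^ n else 0 := fun k => by
      rw [← sub_eq_add_neg, ← intVec_sub, integral_wave hd]
    simp only [he, sub_eq_zero] at h
    have h2 := h.unique (hasSum_single m fun b hb => by rw [if_neg hb.symm, zero_mul])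
    simp only [if_true, wave_add, mul_assoc, tsum_mul_left] at h2
    simp only [exp_modular, modularSeries_eq]
    rw [h2, inv_mul_cancel_left₀ (pow_ne_zero _ hL)]

/-- With `s` fixed, termwise integration in η_Z kills every term with a_X ≠ 0. No uniqueness theorem
enters, hence no exceptional null set. -/
theorem marginal_wignerSeries (hd : 0 < d) {ρ : Modes n →L[ℂ] Modes n}
    (hs : Summable fun a : Lattice n => wignerCoeff d ρ a) (s : Fin n → ℝ) :
    IntegrableOn (fun ηZ => wignerSeries d ρ (s, ηZ)) (cell n d) ∧
      modularSeries d ρ s =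
        ((d : ℂ) ^ n)⁻¹ * ∫ ηZ in cell n d, wignerSeries d ρ (s, ηZ) := by
  obtain ⟨hi, h⟩ := integral_tsum_mul (μ := cellMeasure n d)
    (e := fun (b : Lattice n) z => phaseWave d (-b.2) (-b.1) (s, z))
    (fun b => (continuous_phaseWave _ _).comp (Continuous.prodMk_right s))
    (fun b z => norm_phaseWave _ _ _) hs
  simp only [wignerSeries_eq]
  refine ⟨hi, ?_⟩
  have hinj : Function.Injective fun m : Fin n → ℤ => ((0, m) : Lattice n) :=
    fun m m' h => (Prod.ext_iff.mp h).2
  have hterm : ∀ b : Lattice n, ∫ z, phaseWave d (-b.2) (-b.1) (s, z) ∂(cellMeasure n d) =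
      wave d (-intVec b.2) s * if b.1 = 0 then ((d * ell d : ℝ) : ℂ) ^ n else 0 := fun b => by
    simp only [phaseWave, intVec_neg, neg_neg]
    rw [integral_const_mul, integral_wave hd]
  simp only [hterm] at h
  rw [← hinj.hasSum_iff fun b hb => ?_] at h
  · rw [← (h.mul_left ((d : ℂ) ^ n)⁻¹).tsum_eq, modularSeries_eq]
    refine tsum_congr fun m => ?_
    rw [modularCoeff_eq hd, Function.comp_apply, if_pos rfl]
    ring
  · rw [if_neg, mul_zero, zero_mul]
    exact fun h0 => hb ⟨b.2, Prod.ext h0.symm rfl⟩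

end ZakGross

end

theorem theorem2 (n d : ℕ) (hd : Odd d) (ρ : ZakGross.Modes n →L[ℂ] ZakGross.Modes n)
    (hρ : ZakGross.IsDensityOperator ρ) :
    -- the state has a Zak-Gross Wigner function
    (∃ W : ZakGross.Phase n → ℂ, ZakGross.IsWigner d ρ W) ∧
    -- `s ↦ Tr(ρ M_Z(s))` is the probability density of the outcome of measuring `q mod dℓ`
    (∃ p : (Fin n → ℝ) → ℝ, (∀ s, 0 ≤ p s) ∧
      ZakGross.IsModularDensity d ρ (fun s => (p s : ℂ)) ∧
      ∀ (B : Set (Fin n → ℝ)) (hB : MeasurableSet B), B ⊆ ZakGross.cell n d →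
        ((∫ s in B, p s : ℝ) : ℂ) = ZakGross.trace (ρ ∘L ZakGross.modularProj d hB)) ∧
    -- this density is the marginal of the Zak-Gross Wigner function
    (∀ (W : ZakGross.Phase n → ℂ) (f : (Fin n → ℝ) → ℂ),
      ZakGross.IsWigner d ρ W → ZakGross.IsModularDensity d ρ f →
      ∀ᵐ s ∂(volume.restrict (ZakGross.cell n d)),
        IntegrableOn (fun ηZ => W (s, ηZ)) (ZakGross.cell n d) ∧
        f s = ((d : ℂ) ^ n)⁻¹ * ∫ ηZ in ZakGross.cell n d, W (s, ηZ)) ∧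
    -- when the defining series converges absolutely, this holds at every point for the sums
    (Summable (fun a : ZakGross.Lattice n => ZakGross.wignerCoeff d ρ a) →
      ZakGross.IsWigner d ρ (ZakGross.wignerSeries d ρ) ∧
      ZakGross.IsModularDensity d ρ (ZakGross.modularSeries d ρ) ∧
      ∀ s : Fin n → ℝ,
        IntegrableOn (fun ηZ => ZakGross.wignerSeries d ρ (s, ηZ)) (ZakGross.cell n d) ∧
        ZakGross.modularSeries d ρ s =
          ((d : ℂ) ^ n)⁻¹ * ∫ ηZ in ZakGross.cell n d, ZakGross.wignerSeries d ρ (s, ηZ)) := by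
  exact ⟨hρ.exists_isWigner hd, hρ.exists_modularDensity hd.pos,
    fun _ _ hW hf => hW.marginal hd.pos hf,
    fun hs => ⟨ZakGross.isWigner_wignerSeries hd.pos hs,
      ZakGross.isModularDensity_modularSeries hd.pos (ZakGross.summable_modularCoeff hd.pos hs),
      ZakGross.marginal_wignerSeries hd.pos hs⟩⟩
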